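/- Let $p>1$ and $b>0$. For $\beta\ge 0$ and $\alpha>0$ consider, on $I=(0,1)$, the problem $$-(\beta\|u'\|_2^2+1)\,u''=\lambda\,(u^p+u\sin^2u)\ \text{ in } I,\qquad u>0\ \text{ in } I,\qquad u(0)=u(1)=0,\qquad \|u\|_\infty=\alpha, \tag{$P_\beta$}$$ for pairs $(\lambda,u)$ with $\lambda>0$, $u\in C^2([0,1])$, where $\|u'\|_2^2=\int_0^1u'(x)^2dx$. For every $\alpha>0$, $(P_0)$ has exactly one solution pair $(\mu(\alpha),v_\alpha)$, $(P_b)$ has exactly one solution pair $(\lambda(\alpha),u_\alpha)$, and $u_\alpha=v_\alpha$, $$\lambda(\alpha)=(b\|v_\alpha'\|_2^2+1)\,\mu(\alpha).$$ Moreover, as $\alpha\to\infty$, the following hold, with $C_0,\dots,G_4$ defined below. (i) If $p>2$, $$\begin{aligned}\lambda(\alpha)={}&2(p+1)\alpha^{1-p}\Big\{C_0+(C_1+\tfrac12C_{11})\alpha^{1-p}+\tfrac12(C_{12}+C_{21})\alpha^{-p}+\tfrac12C_{22}\alpha^{-(p+1)}+C_2\alpha^{2(1-p)}+o(\alpha^{2(1-p)})\Big\}^2\\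 &\times\Big\{4b\alpha^2\big\{G_0+G_1\alpha^{1-p}+G_2\alpha^{-p}+G_3\alpha^{-(p+1)}+G_4\alpha^{2(1-p)}+o(\alpha^{2(1-p)})\big\}+1\Big\}.\end{aligned}$$ (ii) If $p=2$, $$\begin{aligned}\lambda(\alpha)={}&6\alpha^{-1}\Big\{C_0+(C_1+\tfrac12C_{11})\alpha^{-1}+(\tfrac12C_{12}+\tfrac12C_{21}+C_2+C_3)\alpha^{-2}+o(\alpha^{-2})\Big\}^2\\ &\times\Big\{4b\alpha^2\big\{G_0+G_1\alpha^{-1}+(G_2+G_4)\alpha^{-2}+o(\alpha^{-2})\big\}+1\Big\}.\end{aligned}$$ (iii) If $1<p<2$, $$\begin{aligned}\lambda(\alpha)={}&2(p+1)\alpha^{1-p}\Big\{C_0+(C_1+\tfrac12C_{11})\alpha^{1-p}+C_2\alpha^{2(1-p)}+o(\alpha^{2(1-p)})\Big\}^2\\ &\times\Big\{4b\alpha^2\big\{G_0+G_1\alpha^{1-p}+G_4\alpha^{2(1-p)}+o(\alpha^{2(1-p)})\big\}+1\Big\}.\end{aligned}$$ In particular $\lambda(\alpha)\sim\alpha^{3-p}$;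 precisely, $\lambda(\alpha)/\alpha^{3-p}\to 8b(p+1)C_0^2G_0>0$. The second terms are oscillatory in the sense that their coefficient $C_{11}=C_{11}(\alpha)$ takes both positive and negative values for arbitrarily large $\alpha$. Here, writing $S=S(\theta)=\sin^{2/(p+1)}\theta$, $$\begin{aligned} C_0&=\int_0^1\frac{ds}{\sqrt{1-s^{p+1}}},\qquad C_1=-\frac{p+1}8\int_0^1\frac{1-s^2}{(1-s^{p+1})^{3/2}}ds,\\ C_2&=\frac{3(p+1)^2}{128}\int_0^1\frac{(1-s^2)^2}{(1-s^{p+1})^{5/2}}ds,\\ C_3&=-\frac{3(p+1)^2}{32}\int_0^1\Big(\int_0^s\frac{1-y^2}{(1-y^{p+1})^{5/2}}dy\Big)\cos(2\alpha s)\,ds,\\ C_{11}&=\frac2{p+1}\int_0^{\pi/2}\cos(2\alpha S)\sin^{\frac{3-p}{p+1}}\theta\,d\theta,\\ C_{12}&=\frac{p-1}{2(p+1)}\int_0^{\pi/2}(\sin2\alpha-\sin(2\alpha S))\sin^{\frac{1-p}{p+1}}\theta\,d\theta+\frac{p+1}4\int_0^1\frac{1-s}{(1-s^{p+1})^{3/2}}\sin(2\alpha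 s)\,ds,\\ C_{21}&=-\frac1{p+1}\int_0^{\pi/2}\sin(2\alpha S)\sin^{\frac{3-p}{p+1}}\theta\,d\theta,\\ C_{22}&=\frac{p-1}{4(p+1)}\int_0^{\pi/2}(\cos2\alpha-\cos(2\alpha S))\sin^{\frac{1-p}{p+1}}\theta\,d\theta,\\ E_0&=\int_0^1\sqrt{1-s^{p+1}}\,ds,\qquad E_1=\frac{p+1}8\int_0^1\frac{1-s^2}{\sqrt{1-s^{p+1}}}ds,\\ E_2&=-\frac14\int_0^{\pi/2}(\sin2\alpha-S\sin(2\alpha S))\sin^{\frac{1-p}{p+1}}\theta\,d\theta,\\ E_3&=-\frac18\int_0^{\pi/2}(\cos2\alpha-\cos(2\alpha S))\sin^{\frac{1-p}{p+1}}\theta\,d\theta,\\ E_4&=-\frac{(p+1)^2}{128}\int_0^1\frac{(1-s^2)^2}{(1-s^{p+1})^{3/2}}ds,\\ G_0&=C_0E_0,\qquad G_1=C_0E_1+(C_1+\tfrac12C_{11})E_0,\\ G_2&=\tfrac12(C_{12}+C_{21})E_0+C_0E_2,\qquad G_3=\tfrac12C_{22}E_0+C_0E_3,\\ G_4&=(C_2+C_3)E_0+C_0E_4+(C_1+\tfrac12C_{11})E_1.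 \end{aligned}$$ -/

import Mathlib

open Real Set Filter Topology Asymptotics

noncomputable section

namespace Kirchhoff

/-- The square `‖u'‖₂²` of the `L²(0,1)`-norm of the derivative. -/
def energy (u : ℝ → ℝ) : ℝ := ∫ x in (0 : ℝ)..1, (deriv u x) ^ 2

/-- `(lam, u)` with `lam > 0` and `u ∈ C²([0,1])` is a solution pair of
`-(b‖u'‖₂² + 1) u'' = lam (u^p + u sin² u)`, `u > 0` on `(0,1)`, `u(0) = u(1) = 0`.
Only the values of `u` on `[0,1]` matter. -/
structure IsSolutionPair (b p lam : ℝ) (u : ℝ → ℝ) : Prop where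
  lam_pos : 0 < lam
  contDiffOn : ContDiffOn ℝ 2 u (Icc 0 1)
  eqn : ∀ x ∈ Ioo (0 : ℝ) 1,
    -(b * energy u + 1) * deriv (deriv u) x = lam * (u x ^ p + u x * sin (u x) ^ 2)
  pos : ∀ x ∈ Ioo (0 : ℝ) 1, 0 < u x
  left : u 0 = 0
  right : u 1 = 0

/-- `‖u‖_∞ = α`, the supremum being over `[0,1]`. -/
def HasSupNorm (u : ℝ → ℝ) (α : ℝ) : Prop :=
  IsLUB ((fun x => |u x|) '' Icc (0 : ℝ) 1) α

/-- `(lam, u)` is a solution pair with `‖u‖_∞ = α`, and it is the only one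
(functions being compared on `[0,1]`). -/
def IsUniqueSolutionPair (b p α lam : ℝ) (u : ℝ → ℝ) : Prop :=
  (IsSolutionPair b p lam u ∧ HasSupNorm u α) ∧
    ∀ (l : ℝ) (w : ℝ → ℝ), IsSolutionPair b p l w → HasSupNorm w α →
      l = lam ∧ EqOn w u (Icc 0 1)

def C0 (p : ℝ) : ℝ := ∫ s in (0 : ℝ)..1, 1 / √(1 - s ^ (p + 1))

def C1 (p : ℝ) : ℝ :=
  -((p + 1) / 8) * ∫ s in (0 : ℝ)..1, (1 - s ^ 2) / (1 - s ^ (p + 1)) ^ (3 / 2 : ℝ)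

def C11 (p α : ℝ) : ℝ :=
  2 / (p + 1) * ∫ θ in (0 : ℝ)..(π / 2),
    cos (2 * α * sin θ ^ (2 / (p + 1))) * sin θ ^ ((3 - p) / (p + 1))

def C12 (p α : ℝ) : ℝ :=
  (p - 1) / (2 * (p + 1)) * (∫ θ in (0 : ℝ)..(π / 2),
      (sin (2 * α) - sin (2 * α * sin θ ^ (2 / (p + 1)))) * sin θ ^ ((1 - p) / (p + 1)))
    + (p + 1) / 4 * ∫ s in (0 : ℝ)..1,
      (1 - s) / (1 - s ^ (p + 1)) ^ (3 / 2 : ℝ) * sin (2 * α * s)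

def C21 (p α : ℝ) : ℝ :=
  -(1 / (p + 1)) * ∫ θ in (0 : ℝ)..(π / 2),
    sin (2 * α * sin θ ^ (2 / (p + 1))) * sin θ ^ ((3 - p) / (p + 1))

def C22 (p α : ℝ) : ℝ :=
  (p - 1) / (4 * (p + 1)) * ∫ θ in (0 : ℝ)..(π / 2),
    (cos (2 * α) - cos (2 * α * sin θ ^ (2 / (p + 1)))) * sin θ ^ ((1 - p) / (p + 1))

def C2 (p : ℝ) : ℝ :=
  3 * (p + 1) ^ 2 / 128 *
    ∫ s in (0 : ℝ)..1, (1 - s ^ 2) ^ 2 / (1 - s ^ (p + 1)) ^ (5 / 2 : ℝ)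

def C3 (p α : ℝ) : ℝ :=
  -(3 / 32) * (p + 1) ^ 2 * ∫ s in (0 : ℝ)..1,
    (∫ y in (0 : ℝ)..s, (1 - y ^ 2) / (1 - y ^ (p + 1)) ^ (5 / 2 : ℝ)) * cos (2 * α * s)

def E0 (p : ℝ) : ℝ := ∫ s in (0 : ℝ)..1, √(1 - s ^ (p + 1))

def E1 (p : ℝ) : ℝ :=
  (p + 1) / 8 * ∫ s in (0 : ℝ)..1, (1 - s ^ 2) / √(1 - s ^ (p + 1))

def E2 (p α : ℝ) : ℝ :=
  -(1 / 4) * ∫ θ in (0 : ℝ)..(π / 2),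
    (sin (2 * α) - sin θ ^ (2 / (p + 1)) * sin (2 * α * sin θ ^ (2 / (p + 1))))
      * sin θ ^ ((1 - p) / (p + 1))

def E3 (p α : ℝ) : ℝ :=
  -(1 / 8) * ∫ θ in (0 : ℝ)..(π / 2),
    (cos (2 * α) - cos (2 * α * sin θ ^ (2 / (p + 1)))) * sin θ ^ ((1 - p) / (p + 1))

def E4 (p : ℝ) : ℝ :=
  -((p + 1) ^ 2 / 128) *
    ∫ s in (0 : ℝ)..1, (1 - s ^ 2) ^ 2 / (1 - s ^ (p + 1)) ^ (3 / 2 : ℝ)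

def G0 (p : ℝ) : ℝ := C0 p * E0 p

def G1 (p α : ℝ) : ℝ := C0 p * E1 p + (C1 p + 1 / 2 * C11 p α) * E0 p

def G2 (p α : ℝ) : ℝ := 1 / 2 * (C12 p α + C21 p α) * E0 p + C0 p * E2 p α

def G3 (p α : ℝ) : ℝ := 1 / 2 * C22 p α * E0 p + C0 p * E3 p α

def G4 (p α : ℝ) : ℝ :=
  (C2 p + C3 p α) * E0 p + C0 p * E4 p + (C1 p + 1 / 2 * C11 p α) * E1 p

end Kirchhoff

end

open Kirchhoff

/-!
The equation is autonomous, so a solution of amplitude `α` is determined by its energy identity: it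
is the inverse of the time map `∫ dy / √(F α - F y)`, with `F` a primitive of `u ^ p + u sin² u`,
reflected about `x = 1 / 2`. The nonlocal factor `b ‖u'‖₂² + 1` is a constant which only rescales
`λ`, so all the problems share their solution and `λ = (b ‖u'‖₂² + 1) · 2 T²` with `T` the time map
at `α`.

Substituting `y = α s` turns `F α - F y` into `1 - s ^ (p + 1)` plus a perturbation
`(p + 1) / 4 · α ^ (1 - p) · ((1 - s²) - ripple)`, where the ripple, coming from
`sin² u = (1 - cos (2 u)) / 2`, oscillates with frequency `α`. Expanding `1 / √` and `√` to second
order in the perturbation, with a cubic remainder, gives the expansions of `T` and of `‖u'‖₂²`. In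
the linear terms an integration by parts lowers the singularity of the ripple at `s = 1`, which
produces `C₁ⱼ`, `C₂ⱼ`, `E₂` and `E₃`; in the quadratic terms and in `C₃` the ripple disappears,
by its decay and by the Riemann-Lebesgue lemma respectively.

Finally `C₁₁ = ∫ s cos (2 α s) / √(1 - s ^ (p + 1)) ds`, and the sign of such an integral at
`α = π n` and `α = π n + π / 2` is decided by the monotonicity and strict convexity of the weight.
-/

noncomputable section

namespace Kirchhoff

open MeasureTheory intervalIntegral

/-- The data of the time map method for `-w'' = κ f(w)` with maximum `α`: a continuous `f`, positive
on `(0,∞)`, an antiderivative `F` of it, and a singularity of `1 / √(F α - F y)` at `y = α` which is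
integrable. -/
structure IsPotential (f F : ℝ → ℝ) (α : ℝ) : Prop where
  continuous : Continuous f
  pos : ∀ u, 0 < u → 0 < f u
  hasDerivAt : ∀ u, HasDerivAt F (f u) u
  amplitude_pos : 0 < α
  intervalIntegrable : IntervalIntegrable (fun y => 1 / √(F α - F y)) volume 0 α

/-- The integrand of the time map. The value `1` outside `(0, α)` makes the time map a homeomorphism
of the line, so that its inverse is defined everywhere. -/
def slowness (F : ℝ → ℝ) (α y : ℝ) : ℝ := if y ∈ Ioo 0 α then 1 / √(F α - F y) else 1

/-- The time map: up to scaling, the time that a solution with maximum `α` takes to climb from `0`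
to `y`. -/
def timeMap (F : ℝ → ℝ) (α y : ℝ) : ℝ := ∫ t in (0 : ℝ)..y, slowness F α t

section timeMap

variable {F : ℝ → ℝ} {α : ℝ}

lemma timeMap_of_nonpos {y : ℝ} (hy : y ≤ 0) : timeMap F α y = y := by
  have : ∫ t in (0 : ℝ)..y, slowness F α t = ∫ _ in (0 : ℝ)..y, 1 := integral_congr fun t ht => by
    rw [uIcc_of_ge hy] at ht
    exact if_neg fun h => h.1.not_ge ht.2
  rw [timeMap, this, integral_one, sub_zero]

lemma timeMap_zero : timeMap F α 0 = 0 := timeMap_of_nonpos le_rfl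

lemma timeMap_amplitude (hα : 0 ≤ α) : timeMap F α α = ∫ y in (0 : ℝ)..α, 1 / √(F α - F y) :=
  integral_congr_Ioo_of_le hα fun _ ht => if_pos ht

lemma measurable_slowness (hF : Measurable F) : Measurable (slowness F α) :=
  Measurable.ite measurableSet_Ioo ((measurable_const.sub hF).sqrt.const_div 1) measurable_const

end timeMap

namespace IsPotential

variable {f F : ℝ → ℝ} {α : ℝ}

lemma continuous_potential (h : IsPotential f F α) : Continuous F :=
  continuous_iff_continuousAt.2 fun u => (h.hasDerivAt u).continuousAt

lemma strictMonoOn_potential (h : IsPotential f F α) : StrictMonoOn F (Ici 0) := by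
  refine strictMonoOn_of_deriv_pos (convex_Ici 0) h.continuous_potential.continuousOn fun x hx => ?_
  rw [interior_Ici] at hx
  rw [(h.hasDerivAt x).deriv]
  exact h.pos x hx

lemma potential_sub_pos (h : IsPotential f F α) {y : ℝ} (hy : y ∈ Ioo 0 α) : 0 < F α - F y :=
  sub_pos.2 (h.strictMonoOn_potential hy.1.le h.amplitude_pos.le hy.2)

lemma slowness_pos (h : IsPotential f F α) (y : ℝ) : 0 < slowness F α y := by
  unfold slowness
  split_ifs with hy
  · exact one_div_pos.2 (Real.sqrt_pos.2 (h.potential_sub_pos hy))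
  · exact one_pos

lemma intervalIntegrable_slowness (h : IsPotential f F α) (a b : ℝ) :
    IntervalIntegrable (slowness F α) volume a b := by
  have slowness_eq : slowness F α =
      fun y => 1 + (Ioo 0 α).indicator (fun y => 1 / √(F α - F y) - 1) y := by
    funext y
    by_cases hy : y ∈ Ioo 0 α
    · simp [slowness, hy]
    · simp only [slowness, if_neg hy, indicator_of_notMem hy, add_zero]
  rw [slowness_eq]
  refine intervalIntegrable_const.add (Integrable.intervalIntegrable ?_)
  rw [integrable_indicator_iff measurableSet_Ioo,
    ← intervalIntegrable_iff_integrableOn_Ioo_of_le h.amplitude_pos.le]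
  exact h.intervalIntegrable.sub intervalIntegrable_const

lemma continuous_timeMap (h : IsPotential f F α) : Continuous (timeMap F α) :=
  continuous_primitive h.intervalIntegrable_slowness 0

lemma timeMap_sub (h : IsPotential f F α) (y z : ℝ) :
    timeMap F α z - timeMap F α y = ∫ t in y..z, slowness F α t :=
  integral_interval_sub_left (h.intervalIntegrable_slowness _ _)
    (h.intervalIntegrable_slowness _ _)

lemma strictMono_timeMap (h : IsPotential f F α) : StrictMono (timeMap F α) := fun y z hyz => by
  rw [← sub_pos, h.timeMap_sub]
  exact intervalIntegral_pos_of_pos_on (h.intervalIntegrable_slowness _ _)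
    (fun t _ => h.slowness_pos t) hyz

lemma timeMap_of_ge (h : IsPotential f F α) {y : ℝ} (hy : α ≤ y) :
    timeMap F α y = timeMap F α α + (y - α) := by
  have : ∫ t in α..y, slowness F α t = ∫ _ in α..y, 1 := integral_congr fun t ht => by
    rw [uIcc_of_le hy] at ht
    exact if_neg fun h => h.2.not_ge ht.1
  rw [← sub_eq_iff_eq_add', h.timeMap_sub, this, integral_one]

lemma timeMap_amplitude_pos (h : IsPotential f F α) : 0 < timeMap F α α := by
  simpa only [timeMap_zero] using h.strictMono_timeMap h.amplitude_pos

lemma surjective_timeMap (h : IsPotential f F α) : Function.Surjective (timeMap F α) := by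
  refine h.continuous_timeMap.surjective ?_ ?_
  · have : Tendsto (fun y => timeMap F α α + (y - α)) atTop atTop :=
      tendsto_atTop_add_const_left _ _ (tendsto_atTop_add_const_right _ _ tendsto_id)
    refine this.congr' ?_
    filter_upwards [eventually_ge_atTop α] with y hy using (h.timeMap_of_ge hy).symm
  · refine tendsto_id.congr' ?_
    filter_upwards [eventually_le_atBot 0] with y hy using (timeMap_of_nonpos hy).symm

lemma hasDerivAt_timeMap (h : IsPotential f F α) {y : ℝ} (hy : y ∈ Ioo 0 α) :
    HasDerivAt (timeMap F α) (1 / √(F α - F y)) y := by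
  have slowness_eq : slowness F α =ᶠ[𝓝 y] fun y => 1 / √(F α - F y) := by
    filter_upwards [isOpen_Ioo.mem_nhds hy] with t ht using if_pos ht
  have hcont : ContinuousAt (fun y => 1 / √(F α - F y)) y :=
    continuousAt_const.div (continuousAt_const.sub h.continuous_potential.continuousAt).sqrt
      (Real.sqrt_pos.2 (h.potential_sub_pos hy)).ne'
  have hmeas := measurable_slowness (α := α) h.continuous_potential.measurable
  rw [← slowness_eq.eq_of_nhds]
  exact integral_hasDerivAt_right (h.intervalIntegrable_slowness 0 y)
    ⟨univ, univ_mem, hmeas.aestronglyMeasurable⟩ (hcont.congr slowness_eq.symm)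

/-- The time map as an order isomorphism of the line. -/
def timeIso (h : IsPotential f F α) : ℝ ≃o ℝ :=
  h.strictMono_timeMap.orderIsoOfSurjective _ h.surjective_timeMap

/-- The values on `[0,1]` of the solution with maximum `α`. It is symmetric about `1/2` and climbs
from `0` to `α` on `[0,1/2]` in such a way that `timeMap F α (profile x)` is linear there. -/
def profile (h : IsPotential f F α) (x : ℝ) : ℝ :=
  h.timeIso.symm (2 * timeMap F α α * min x (1 - x))

lemma timeMap_profile (h : IsPotential f F α) (x : ℝ) :
    timeMap F α (h.profile x) = 2 * timeMap F α α * min x (1 - x) :=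
  h.timeIso.apply_symm_apply _

lemma continuous_profile (h : IsPotential f F α) : Continuous h.profile :=
  h.timeIso.symm.continuous.comp (by fun_prop)

lemma profile_one_sub (h : IsPotential f F α) (x : ℝ) : h.profile (1 - x) = h.profile x := by
  rw [profile, profile, sub_sub_cancel, min_comm]

lemma profile_zero (h : IsPotential f F α) : h.profile 0 = 0 :=
  h.strictMono_timeMap.injective (by simp [h.timeMap_profile, timeMap_zero])

lemma profile_one (h : IsPotential f F α) : h.profile 1 = 0 := by
  simpa only [sub_zero, h.profile_zero] using h.profile_one_sub 0

lemma profile_half (h : IsPotential f F α) : h.profile (1 / 2) = α := by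
  apply h.strictMono_timeMap.injective
  rw [h.timeMap_profile, sub_self_div_two, min_self]
  ring

lemma profile_pos (h : IsPotential f F α) {x : ℝ} (hx : x ∈ Ioo (0 : ℝ) 1) : 0 < h.profile x := by
  rw [← h.strictMono_timeMap.lt_iff_lt, timeMap_zero, h.timeMap_profile]
  exact mul_pos (mul_pos two_pos h.timeMap_amplitude_pos) (lt_min hx.1 (sub_pos.2 hx.2))

lemma profile_lt (h : IsPotential f F α) {x : ℝ} (hx : x ≠ 1 / 2) : h.profile x < α := by
  have hmin : min x (1 - x) < 1 / 2 := min_lt_iff.2 (hx.lt_or_gt.imp_right fun hx => by linarith)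
  rw [← h.strictMono_timeMap.lt_iff_lt, h.timeMap_profile]
  nlinarith [h.timeMap_amplitude_pos]

lemma profile_le (h : IsPotential f F α) (x : ℝ) : h.profile x ≤ α := by
  rcases eq_or_ne x (1 / 2) with rfl | hx
  · exact h.profile_half.le
  · exact (h.profile_lt hx).le

lemma profile_mem_Ioo (h : IsPotential f F α) {x : ℝ} (hx : x ∈ Ioo (0 : ℝ) (1 / 2)) :
    h.profile x ∈ Ioo 0 α :=
  ⟨h.profile_pos ⟨hx.1, by linarith [hx.2]⟩, h.profile_lt hx.2.ne⟩

lemma hasDerivAt_profile_of_lt_half (h : IsPotential f F α) {x : ℝ}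
    (hx : x ∈ Ioo (0 : ℝ) (1 / 2)) :
    HasDerivAt h.profile (2 * timeMap F α α * √(F α - F (h.profile x))) x := by
  have profile_eq : h.profile =ᶠ[𝓝 x] fun x => h.timeIso.symm (2 * timeMap F α α * x) := by
    filter_upwards [isOpen_Ioo.mem_nhds hx] with t ht
    rw [profile, min_eq_left (by linarith [ht.2])]
  have hsqrt : 0 < √(F α - F (h.profile x)) :=
    Real.sqrt_pos.2 (h.potential_sub_pos (h.profile_mem_Ioo hx))
  have hinv : HasDerivAt h.timeIso.symm (1 / √(F α - F (h.profile x)))⁻¹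
      (2 * timeMap F α α * x) := by
    refine HasDerivAt.of_local_left_inverse (f := timeMap F α)
      h.timeIso.symm.continuous.continuousAt ?_ (by positivity)
      (Eventually.of_forall h.timeIso.apply_symm_apply)
    rw [← profile_eq.eq_of_nhds]
    exact h.hasDerivAt_timeMap (h.profile_mem_Ioo hx)
  have hcomp := hinv.comp x ((hasDerivAt_id x).const_mul (2 * timeMap F α α))
  refine (hcomp.congr_of_eventuallyEq profile_eq).congr_deriv ?_
  rw [one_div, inv_inv, mul_one, mul_comm]

/-- The derivative of `profile` on `[0,1]`. -/
def slope (h : IsPotential f F α) (x : ℝ) : ℝ :=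
  if x ≤ 1 / 2 then 2 * timeMap F α α * √(F α - F (h.profile x))
  else -(2 * timeMap F α α * √(F α - F (h.profile x)))

/-- The second derivative of `profile` on `[0,1]`. -/
def accel (h : IsPotential f F α) (x : ℝ) : ℝ := -(2 * timeMap F α α ^ 2) * f (h.profile x)

lemma continuous_slope (h : IsPotential f F α) : Continuous h.slope := by
  have hleft : Continuous fun x => 2 * timeMap F α α * √(F α - F (h.profile x)) :=
    (continuous_const.sub (h.continuous_potential.comp h.continuous_profile)).sqrt.const_mul _
  refine Continuous.if_le hleft hleft.neg continuous_id continuous_const ?_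
  rintro x rfl
  rw [h.profile_half, sub_self, Real.sqrt_zero, mul_zero, neg_zero]

lemma continuous_accel (h : IsPotential f F α) : Continuous h.accel :=
  (h.continuous.comp h.continuous_profile).const_mul _

lemma slope_one_sub (h : IsPotential f F α) (x : ℝ) : h.slope (1 - x) = -h.slope x := by
  rw [slope, slope, h.profile_one_sub]
  rcases lt_trichotomy x (1 / 2) with hx | rfl | hx
  · rw [if_neg (by linarith), if_pos hx.le]
  · simp only [h.profile_half, sub_self, Real.sqrt_zero, mul_zero, neg_zero, ite_self]
  · rw [if_pos (by linarith), if_neg (by linarith), neg_neg]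

lemma accel_one_sub (h : IsPotential f F α) (x : ℝ) : h.accel (1 - x) = h.accel x := by
  rw [accel, accel, h.profile_one_sub]

lemma hasDerivAt_slope_of_lt_half (h : IsPotential f F α) {x : ℝ} (hx : x ∈ Ioo (0 : ℝ) (1 / 2)) :
    HasDerivAt h.slope (h.accel x) x := by
  have hpos := h.potential_sub_pos (h.profile_mem_Ioo hx)
  have : 0 < √(F α - F (h.profile x)) := Real.sqrt_pos.2 hpos
  have slope_eq : h.slope =ᶠ[𝓝 x] fun x => 2 * timeMap F α α * √(F α - F (h.profile x)) := by
    filter_upwards [isOpen_Ioo.mem_nhds hx] with t ht using if_pos ht.2.le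
  have hderiv := (((h.hasDerivAt (h.profile x)).comp x
    (h.hasDerivAt_profile_of_lt_half hx)).const_sub (F α)).sqrt hpos.ne'
  refine ((hderiv.const_mul (2 * timeMap F α α)).congr_of_eventuallyEq slope_eq).congr_deriv ?_
  rw [accel]
  simp only [Function.comp_apply]
  field_simp

lemma hasDerivAt_profile (h : IsPotential f F α) {x : ℝ}
    (hx : x ∈ Ioo (0 : ℝ) 1 \ {1 / 2}) : HasDerivAt h.profile (h.slope x) x := by
  have left {t : ℝ} (ht : t ∈ Ioo (0 : ℝ) (1 / 2)) : HasDerivAt h.profile (h.slope t) t := by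
    rw [slope, if_pos ht.2.le]
    exact h.hasDerivAt_profile_of_lt_half ht
  rcases (show x ≠ 1 / 2 from hx.2).lt_or_gt with hlt | hgt
  · exact left ⟨hx.1.1, hlt⟩
  · have reflected := (left (t := 1 - x) ⟨by linarith [hx.1.2], by linarith⟩).comp_const_sub 1 x
    simpa only [h.profile_one_sub, h.slope_one_sub, neg_neg] using reflected

lemma hasDerivAt_slope (h : IsPotential f F α) {x : ℝ}
    (hx : x ∈ Ioo (0 : ℝ) 1 \ {1 / 2}) : HasDerivAt h.slope (h.accel x) x := by
  rcases (show x ≠ 1 / 2 from hx.2).lt_or_gt with hlt | hgt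
  · exact h.hasDerivAt_slope_of_lt_half ⟨hx.1.1, hlt⟩
  · have reflected := ((h.hasDerivAt_slope_of_lt_half (x := 1 - x)
      ⟨by linarith [hx.1.2], by linarith⟩).comp_const_sub 1 x).fun_neg
    simpa only [h.slope_one_sub, h.accel_one_sub, neg_neg] using reflected

/-- An antiderivative of `accel` on the whole line that agrees with `slope` on `[0,1]`. -/
def slopeExt (h : IsPotential f F α) (x : ℝ) : ℝ := h.slope 0 + ∫ t in (0 : ℝ)..x, h.accel t

/-- The solution with maximum `α`: a `C²` function on the whole line that agrees with `profile` on
`[0,1]`. -/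
def solution (h : IsPotential f F α) (x : ℝ) : ℝ := ∫ t in (0 : ℝ)..x, h.slopeExt t

lemma hasDerivAt_slopeExt (h : IsPotential f F α) (x : ℝ) :
    HasDerivAt h.slopeExt (h.accel x) x :=
  (h.continuous_accel.integral_hasStrictDerivAt 0 x).hasDerivAt.const_add _

lemma continuous_slopeExt (h : IsPotential f F α) : Continuous h.slopeExt :=
  continuous_iff_continuousAt.2 fun u => (h.hasDerivAt_slopeExt u).continuousAt

lemma hasDerivAt_solution (h : IsPotential f F α) (x : ℝ) :
    HasDerivAt h.solution (h.slopeExt x) x :=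
  (h.continuous_slopeExt.integral_hasStrictDerivAt 0 x).hasDerivAt

lemma deriv_solution (h : IsPotential f F α) : deriv h.solution = h.slopeExt :=
  funext fun x => (h.hasDerivAt_solution x).deriv

lemma deriv_slopeExt (h : IsPotential f F α) : deriv h.slopeExt = h.accel :=
  funext fun x => (h.hasDerivAt_slopeExt x).deriv

lemma contDiff_solution (h : IsPotential f F α) : ContDiff ℝ 2 h.solution := by
  rw [show (2 : WithTop ℕ∞) = 1 + 1 by norm_num, contDiff_succ_iff_deriv, h.deriv_solution,
    contDiff_one_iff_deriv, h.deriv_slopeExt]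
  exact ⟨fun x => (h.hasDerivAt_solution x).differentiableAt, by simp,
    fun x => (h.hasDerivAt_slopeExt x).differentiableAt, h.continuous_accel⟩

lemma slopeExt_eq_slope (h : IsPotential f F α) {x : ℝ} (hx : x ∈ Icc (0 : ℝ) 1) :
    h.slopeExt x = h.slope x := by
  have ftc := integral_eq_of_hasDerivAt_off_countable_of_le h.slope h.accel hx.1
    (countable_singleton (1 / 2)) h.continuous_slope.continuousOn
    (fun t ht => h.hasDerivAt_slope ⟨⟨ht.1.1, ht.1.2.trans_le hx.2⟩, ht.2⟩)
    (h.continuous_accel.intervalIntegrable _ _)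
  rw [slopeExt, ftc, add_sub_cancel]

lemma solution_eq_profile (h : IsPotential f F α) {x : ℝ} (hx : x ∈ Icc (0 : ℝ) 1) :
    h.solution x = h.profile x := by
  have ftc := integral_eq_of_hasDerivAt_off_countable_of_le h.profile h.slope hx.1
    (countable_singleton (1 / 2)) h.continuous_profile.continuousOn
    (fun t ht => h.hasDerivAt_profile ⟨⟨ht.1.1, ht.1.2.trans_le hx.2⟩, ht.2⟩)
    (h.continuous_slope.intervalIntegrable _ _)
  rw [h.profile_zero, sub_zero] at ftc
  rw [solution, ← ftc]
  exact integral_congr_Ioo_of_le hx.1 fun t ht =>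
    h.slopeExt_eq_slope ⟨ht.1.le, ht.2.le.trans hx.2⟩

lemma neg_deriv_deriv_solution (h : IsPotential f F α) {x : ℝ} (hx : x ∈ Icc (0 : ℝ) 1) :
    -deriv (deriv h.solution) x = 2 * timeMap F α α ^ 2 * f (h.solution x) := by
  rw [h.deriv_solution, h.deriv_slopeExt, h.solution_eq_profile hx, accel, neg_mul, neg_neg]

lemma solution_nonneg (h : IsPotential f F α) {x : ℝ} (hx : x ∈ Icc (0 : ℝ) 1) :
    0 ≤ h.solution x := by
  rw [h.solution_eq_profile hx]
  rcases eq_endpoints_or_mem_Ioo_of_mem_Icc hx with rfl | rfl | hx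
  · exact h.profile_zero.ge
  · exact h.profile_one.ge
  · exact (h.profile_pos hx).le

lemma hasSupNorm_solution (h : IsPotential f F α) : HasSupNorm h.solution α := by
  refine IsGreatest.isLUB ⟨⟨1 / 2, ⟨by norm_num, by norm_num⟩, ?_⟩, ?_⟩
  · change |h.solution (1 / 2)| = α
    rw [h.solution_eq_profile ⟨by norm_num, by norm_num⟩, h.profile_half,
      abs_of_pos h.amplitude_pos]
  · rintro _ ⟨x, hx, rfl⟩
    change |h.solution x| ≤ α
    rw [abs_of_nonneg (h.solution_nonneg hx), h.solution_eq_profile hx]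
    exact h.profile_le x

lemma intervalIntegrable_slope_sq (h : IsPotential f F α) (a b : ℝ) :
    IntervalIntegrable (fun x => h.slope x ^ 2) volume a b :=
  (h.continuous_slope.pow 2).intervalIntegrable a b

lemma integral_slope_sq_left (h : IsPotential f F α) :
    ∫ x in (0 : ℝ)..(1 / 2), h.slope x ^ 2 =
      2 * timeMap F α α * ∫ y in (0 : ℝ)..α, √(F α - F y) := by
  set Q : ℝ → ℝ := fun z => ∫ y in (0 : ℝ)..z, √(F α - F y) with hQ
  have hasDerivAt_Q (z : ℝ) : HasDerivAt Q (√(F α - F z)) z :=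
    ((continuous_const.sub h.continuous_potential).sqrt.integral_hasStrictDerivAt 0 z).hasDerivAt
  have continuous_Q : Continuous Q :=
    continuous_iff_continuousAt.2 fun z => (hasDerivAt_Q z).continuousAt
  rw [integral_eq_sub_of_hasDerivAt_of_le (f := fun x => 2 * timeMap F α α * Q (h.profile x))
    (by norm_num) ((continuous_Q.comp h.continuous_profile).const_mul _).continuousOn
    (fun x hx => ?_) (h.intervalIntegrable_slope_sq _ _)]
  · simp only [h.profile_half, h.profile_zero, hQ, integral_same, mul_zero, sub_zero]
  · have hderiv := ((hasDerivAt_Q (h.profile x)).comp x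
      (h.hasDerivAt_profile_of_lt_half hx)).const_mul (2 * timeMap F α α)
    refine hderiv.congr_deriv ?_
    rw [slope, if_pos hx.2.le]
    ring

lemma energy_solution (h : IsPotential f F α) :
    energy h.solution = 4 * timeMap F α α * ∫ y in (0 : ℝ)..α, √(F α - F y) := by
  have right_half : ∫ x in (1 / 2 : ℝ)..1, h.slope x ^ 2 =
      ∫ x in (0 : ℝ)..(1 / 2), h.slope x ^ 2 := by
    have reflect := integral_comp_sub_left (a := 0) (b := 1 / 2) (fun x => h.slope x ^ 2) 1
    simpa only [h.slope_one_sub, neg_sq, sub_zero, sub_self_div_two] using reflect.symm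
  calc energy h.solution = ∫ x in (0 : ℝ)..1, h.slope x ^ 2 :=
        integral_congr_Ioo_of_le zero_le_one fun x hx => by
          simp only [h.deriv_solution, h.slopeExt_eq_slope (Ioo_subset_Icc_self hx)]
    _ = 2 * ∫ x in (0 : ℝ)..(1 / 2), h.slope x ^ 2 := by
        rw [← integral_add_adjacent_intervals (h.intervalIntegrable_slope_sq 0 (1 / 2))
          (h.intervalIntegrable_slope_sq (1 / 2) 1), right_half, two_mul]
    _ = _ := by rw [h.integral_slope_sq_left]; ring

end IsPotential

/-- `w` solves `-w'' = κ f(w)` on `(0,1)` with `κ > 0`, is positive there, vanishes at `0` and `1`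
and is at most `α`; `w'` is its derivative. -/
structure IsDirichletSolution (f : ℝ → ℝ) (α κ : ℝ) (w w' : ℝ → ℝ) : Prop where
  param_pos : 0 < κ
  continuousOn : ContinuousOn w (Icc 0 1)
  hasDerivAt : ∀ x ∈ Ioo (0 : ℝ) 1, HasDerivAt w (w' x) x
  hasDerivAt_deriv : ∀ x ∈ Ioo (0 : ℝ) 1, HasDerivAt w' (-(κ * f (w x))) x
  pos : ∀ x ∈ Ioo (0 : ℝ) 1, 0 < w x
  left : w 0 = 0
  right : w 1 = 0
  le : ∀ x ∈ Icc (0 : ℝ) 1, w x ≤ α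

namespace IsDirichletSolution

variable {f F : ℝ → ℝ} {α κ c : ℝ} {w w' : ℝ → ℝ}

lemma reflect (hw : IsDirichletSolution f α κ w w') :
    IsDirichletSolution f α κ (fun x => w (1 - x)) (fun x => -w' (1 - x)) where
  param_pos := hw.param_pos
  continuousOn := hw.continuousOn.comp (by fun_prop)
    fun x hx => ⟨by linarith [hx.2], by linarith [hx.1]⟩
  hasDerivAt x hx :=
    (hw.hasDerivAt (1 - x) ⟨by linarith [hx.2], by linarith [hx.1]⟩).comp_const_sub 1 x
  hasDerivAt_deriv x hx := by
    simpa only [neg_neg] using ((hw.hasDerivAt_deriv (1 - x)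
      ⟨by linarith [hx.2], by linarith [hx.1]⟩).comp_const_sub 1 x).fun_neg
  pos x hx := hw.pos _ ⟨by linarith [hx.2], by linarith [hx.1]⟩
  left := by simpa only [sub_zero] using hw.right
  right := by simpa only [sub_self] using hw.left
  le x hx := hw.le _ ⟨by linarith [hx.2], by linarith [hx.1]⟩

lemma deriv_eq_zero (hw : IsDirichletSolution f α κ w w') (hc : c ∈ Ioo (0 : ℝ) 1)
    (hwc : w c = α) : w' c = 0 := by
  refine IsLocalMax.hasDerivAt_eq_zero ?_ (hw.hasDerivAt c hc)
  filter_upwards [isOpen_Ioo.mem_nhds hc] with t ht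
  exact hwc ▸ hw.le t (Ioo_subset_Icc_self ht)

lemma strictAntiOn_deriv (hw : IsDirichletSolution f α κ w w') (hf : ∀ u, 0 < u → 0 < f u) :
    StrictAntiOn w' (Ioo 0 1) := by
  refine strictAntiOn_of_deriv_neg (convex_Ioo 0 1)
    (fun t ht => (hw.hasDerivAt_deriv t ht).continuousAt.continuousWithinAt) fun t ht => ?_
  rw [interior_Ioo] at ht
  rw [(hw.hasDerivAt_deriv t ht).deriv]
  exact neg_neg_of_pos (mul_pos hw.param_pos (hf _ (hw.pos t ht)))

lemma deriv_pos (hw : IsDirichletSolution f α κ w w') (hf : ∀ u, 0 < u → 0 < f u)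
    (hc : c ∈ Ioo (0 : ℝ) 1) (hwc : w c = α) {t : ℝ} (ht : t ∈ Ioo 0 c) : 0 < w' t := by
  rw [← hw.deriv_eq_zero hc hwc]
  exact hw.strictAntiOn_deriv hf (Ioo_subset_Ioo_right hc.2.le ht) hc ht.2

lemma deriv_sq (hw : IsDirichletSolution f α κ w w') (hF : ∀ u, HasDerivAt F (f u) u)
    (hc : c ∈ Ioo (0 : ℝ) 1) (hwc : w c = α) {t : ℝ} (ht : t ∈ Ioo (0 : ℝ) 1) :
    w' t ^ 2 = 2 * κ * (F α - F (w t)) := by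
  have hasDerivAt_energy : ∀ s ∈ Ioo (0 : ℝ) 1,
      HasDerivAt (fun s => w' s ^ 2 + 2 * κ * F (w s)) 0 s := fun s hs => by
    refine (((hw.hasDerivAt_deriv s hs).pow 2).add
      (((hF (w s)).comp s (hw.hasDerivAt s hs)).const_mul (2 * κ))).congr_deriv ?_
    ring
  have conserved := isOpen_Ioo.is_const_of_deriv_eq_zero isPreconnected_Ioo
    (fun s hs => (hasDerivAt_energy s hs).differentiableAt.differentiableWithinAt)
    (fun s hs => (hasDerivAt_energy s hs).deriv) ht hc
  simp only [hw.deriv_eq_zero hc hwc, hwc] at conserved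
  linarith

lemma mem_Ioo (hw : IsDirichletSolution f α κ w w') (h : IsPotential f F α)
    (hc : c ∈ Ioo (0 : ℝ) 1) (hwc : w c = α) {t : ℝ} (ht : t ∈ Ioo 0 c) : w t ∈ Ioo 0 α := by
  have ht' : t ∈ Ioo (0 : ℝ) 1 := Ioo_subset_Ioo_right hc.2.le ht
  refine ⟨hw.pos t ht', (hw.le t (Ioo_subset_Icc_self ht')).lt_of_ne fun heq => ?_⟩
  have hsq := hw.deriv_sq h.hasDerivAt hc hwc ht'
  rw [heq, sub_self, mul_zero] at hsq
  exact (pow_pos (hw.deriv_pos h.pos hc hwc ht) 2).ne' hsq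

lemma hasDerivAt_timeMap (hw : IsDirichletSolution f α κ w w') (h : IsPotential f F α)
    (hc : c ∈ Ioo (0 : ℝ) 1) (hwc : w c = α) {t : ℝ} (ht : t ∈ Ioo 0 c) :
    HasDerivAt (fun s => timeMap F α (w s)) √(2 * κ) t := by
  have ht' : t ∈ Ioo (0 : ℝ) 1 := Ioo_subset_Ioo_right hc.2.le ht
  have hmem := hw.mem_Ioo h hc hwc ht
  have speed : w' t = √(2 * κ) * √(F α - F (w t)) := by
    rw [← Real.sqrt_mul (mul_pos two_pos hw.param_pos).le, ← hw.deriv_sq h.hasDerivAt hc hwc ht',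
      Real.sqrt_sq (hw.deriv_pos h.pos hc hwc ht).le]
  refine ((h.hasDerivAt_timeMap hmem).comp t (hw.hasDerivAt t ht')).congr_deriv ?_
  rw [speed, one_div, mul_left_comm, inv_mul_cancel₀, mul_one]
  exact (Real.sqrt_pos.2 (h.potential_sub_pos hmem)).ne'

lemma timeMap_eq (hw : IsDirichletSolution f α κ w w') (h : IsPotential f F α)
    (hc : c ∈ Ioo (0 : ℝ) 1) (hwc : w c = α) {x : ℝ} (hx : x ∈ Icc 0 c) :
    timeMap F α (w x) = √(2 * κ) * x := by
  have ftc := integral_eq_sub_of_hasDerivAt_of_le (f := fun s => timeMap F α (w s)) hx.1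
    (h.continuous_timeMap.comp_continuousOn
      (hw.continuousOn.mono (Icc_subset_Icc_right (hx.2.trans hc.2.le))))
    (fun t ht => hw.hasDerivAt_timeMap h hc hwc ⟨ht.1, ht.2.trans_le hx.2⟩)
    intervalIntegrable_const
  rw [intervalIntegral.integral_const, hw.left, timeMap_zero, smul_eq_mul] at ftc
  linarith

lemma timeMap_eq_right (hw : IsDirichletSolution f α κ w w') (h : IsPotential f F α)
    (hc : c ∈ Ioo (0 : ℝ) 1) (hwc : w c = α) {x : ℝ} (hx : x ∈ Icc c 1) :
    timeMap F α (w x) = √(2 * κ) * (1 - x) := by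
  have reflected := hw.reflect.timeMap_eq h (c := 1 - c) ⟨by linarith [hc.2], by linarith [hc.1]⟩
    (by rwa [sub_sub_cancel]) (x := 1 - x) ⟨by linarith [hx.2], by linarith [hx.1]⟩
  rwa [sub_sub_cancel] at reflected

lemma mem_Ioo_of_eq_max (hw : IsDirichletSolution f α κ w w') (hα : 0 < α)
    (hc : c ∈ Icc (0 : ℝ) 1) (hwc : w c = α) : c ∈ Ioo (0 : ℝ) 1 := by
  rcases eq_endpoints_or_mem_Ioo_of_mem_Icc hc with rfl | rfl | hc
  · exact absurd (hw.left.symm.trans hwc) hα.ne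
  · exact absurd (hw.right.symm.trans hwc) hα.ne
  · exact hc

lemma eq_half_of_eq_max (hw : IsDirichletSolution f α κ w w') (h : IsPotential f F α)
    (hc : c ∈ Ioo (0 : ℝ) 1) (hwc : w c = α) : c = 1 / 2 := by
  have hκ : 0 < √(2 * κ) := Real.sqrt_pos.2 (mul_pos two_pos hw.param_pos)
  have climb_eq_descent := (hw.timeMap_eq h hc hwc (right_mem_Icc.2 hc.1.le)).symm.trans
    (hw.timeMap_eq_right h hc hwc (left_mem_Icc.2 hc.2.le))
  linarith [mul_left_cancel₀ hκ.ne' climb_eq_descent]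

lemma sqrt_two_mul_param (hw : IsDirichletSolution f α κ w w') (h : IsPotential f F α)
    (hc : c ∈ Ioo (0 : ℝ) 1) (hwc : w c = α) : √(2 * κ) = 2 * timeMap F α α := by
  have climb := hw.timeMap_eq h hc hwc (right_mem_Icc.2 hc.1.le)
  rw [hwc, hw.eq_half_of_eq_max h hc hwc] at climb
  linarith

lemma param_eq (hw : IsDirichletSolution f α κ w w') (h : IsPotential f F α)
    (hc : c ∈ Icc (0 : ℝ) 1) (hwc : w c = α) : κ = 2 * timeMap F α α ^ 2 := by
  have hsq := Real.sq_sqrt (mul_pos two_pos hw.param_pos).le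
  rw [hw.sqrt_two_mul_param h (hw.mem_Ioo_of_eq_max h.amplitude_pos hc hwc) hwc] at hsq
  linarith

lemma eqOn_profile (hw : IsDirichletSolution f α κ w w') (h : IsPotential f F α)
    (hc : c ∈ Icc (0 : ℝ) 1) (hwc : w c = α) : EqOn w h.profile (Icc 0 1) := by
  replace hc := hw.mem_Ioo_of_eq_max h.amplitude_pos hc hwc
  have hhalf := hw.eq_half_of_eq_max h hc hwc
  refine fun x hx => h.strictMono_timeMap.injective ?_
  rw [h.timeMap_profile, ← hw.sqrt_two_mul_param h hc hwc]
  rcases le_total x c with hxc | hxc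
  · rw [min_eq_left (by linarith), hw.timeMap_eq h hc hwc ⟨hx.1, hxc⟩]
  · rw [min_eq_right (by linarith), hw.timeMap_eq_right h hc hwc ⟨hxc, hx.2⟩]

end IsDirichletSolution

lemma energy_nonneg (u : ℝ → ℝ) : 0 ≤ energy u :=
  integral_nonneg zero_le_one fun _ _ => sq_nonneg _

lemma energy_congr {u v : ℝ → ℝ} (h : EqOn u v (Icc 0 1)) : energy u = energy v :=
  integral_congr_Ioo_of_le zero_le_one fun x hx => by
    have : u =ᶠ[𝓝 x] v := by
      filter_upwards [Icc_mem_nhds hx.1 hx.2] with t ht using h ht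
    simp only [this.deriv_eq]

lemma mul_energy_add_one_pos {b : ℝ} (hb : 0 ≤ b) (u : ℝ → ℝ) : 0 < b * energy u + 1 :=
  add_pos_of_nonneg_of_pos (mul_nonneg hb (energy_nonneg u)) one_pos

/-- The nonlinearity `u^p + u sin² u`. -/
def source (p u : ℝ) : ℝ := u ^ p + u * sin u ^ 2

section solutionPair

variable {b p l α : ℝ} {w : ℝ → ℝ}

lemma IsSolutionPair.isDirichletSolution (hw : IsSolutionPair b p l w) (hb : 0 ≤ b)
    (hs : HasSupNorm w α) :
    IsDirichletSolution (source p) α (l / (b * energy w + 1)) w (deriv w) := by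
  have hE := mul_energy_add_one_pos hb w
  have hcd : ∀ x ∈ Ioo (0 : ℝ) 1, ContDiffAt ℝ 2 w x := fun x hx =>
    hw.contDiffOn.contDiffAt (Icc_mem_nhds hx.1 hx.2)
  refine ⟨div_pos hw.lam_pos hE, hw.contDiffOn.continuousOn,
    fun x hx => ((hcd x hx).differentiableAt two_ne_zero).hasDerivAt, fun x hx => ?_, hw.pos,
    hw.left, hw.right, fun x hx => (le_abs_self _).trans (hs.1 ⟨x, hx, rfl⟩)⟩
  have hcd_deriv : ContDiffAt ℝ 1 (deriv w) x :=
    ((hcd x hx).fderiv_right (m := 1) (by norm_num)).clm_apply contDiffAt_const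
  refine (hcd_deriv.differentiableAt one_ne_zero).hasDerivAt.congr_deriv ?_
  have heqn := hw.eqn x hx
  rw [source]
  field_simp
  linarith

lemma IsSolutionPair.nonneg (hw : IsSolutionPair b p l w) {x : ℝ} (hx : x ∈ Icc (0 : ℝ) 1) :
    0 ≤ w x := by
  rcases eq_endpoints_or_mem_Ioo_of_mem_Icc hx with rfl | rfl | hx
  · exact hw.left.ge
  · exact hw.right.ge
  · exact (hw.pos x hx).le

lemma IsSolutionPair.exists_eq_supNorm (hw : IsSolutionPair b p l w) (hs : HasSupNorm w α) :
    ∃ c ∈ Icc (0 : ℝ) 1, w c = α := by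
  have hne : ((fun x => |w x|) '' Icc (0 : ℝ) 1).Nonempty := (nonempty_Icc.2 zero_le_one).image _
  obtain ⟨c, hc, habs⟩ :=
    (isCompact_Icc.image_of_continuousOn hw.contDiffOn.continuousOn.abs).sSup_mem hne
  rw [hs.csSup_eq hne] at habs
  exact ⟨c, hc, (abs_of_nonneg (hw.nonneg hc)).symm.trans habs⟩

variable {F : ℝ → ℝ}

lemma IsPotential.isSolutionPair (h : IsPotential (source p) F α) (hb : 0 ≤ b) :
    IsSolutionPair b p ((b * energy h.solution + 1) * (2 * timeMap F α α ^ 2)) h.solution where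
  lam_pos := mul_pos (mul_energy_add_one_pos hb _)
    (mul_pos two_pos (pow_pos h.timeMap_amplitude_pos 2))
  contDiffOn := h.contDiff_solution.contDiffOn
  eqn x hx := by
    rw [neg_mul, ← mul_neg, h.neg_deriv_deriv_solution (Ioo_subset_Icc_self hx), source]
    ring
  pos x hx := by
    rw [h.solution_eq_profile (Ioo_subset_Icc_self hx)]
    exact h.profile_pos hx
  left := by rw [h.solution_eq_profile (left_mem_Icc.2 zero_le_one), h.profile_zero]
  right := by rw [h.solution_eq_profile (right_mem_Icc.2 zero_le_one), h.profile_one]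

theorem IsPotential.isUniqueSolutionPair (h : IsPotential (source p) F α) (hb : 0 ≤ b) :
    IsUniqueSolutionPair b p α ((b * energy h.solution + 1) * (2 * timeMap F α α ^ 2))
      h.solution := by
  refine ⟨⟨h.isSolutionPair hb, h.hasSupNorm_solution⟩, fun l w hw hs => ?_⟩
  obtain ⟨c, hc, hwc⟩ := hw.exists_eq_supNorm hs
  have hsol := hw.isDirichletSolution hb hs
  have heqOn : EqOn w h.solution (Icc 0 1) := fun x hx => by
    rw [hsol.eqOn_profile h hc hwc hx, h.solution_eq_profile hx]
  refine ⟨?_, heqOn⟩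
  rw [← energy_congr heqOn, ← hsol.param_eq h hc hwc,
    mul_div_cancel₀ _ (mul_energy_add_one_pos hb w).ne']

end solutionPair

/-- The antiderivative of `u sin² u` vanishing at `0`. -/
def sinPot (u : ℝ) : ℝ := u ^ 2 / 4 - u * sin (2 * u) / 4 - cos (2 * u) / 8 + 1 / 8

/-- The antiderivative of `source p` vanishing at `0`. -/
def sourcePot (p u : ℝ) : ℝ := u ^ (p + 1) / (p + 1) + sinPot u

/-- The weight `1 - s^{p+1}` of all the integrals below. -/
def gap (p s : ℝ) : ℝ := 1 - s ^ (p + 1)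

/-- What the term `u sin² u` adds to `gap p s` in the difference of the potential at `α` and at
`α s`. -/
def pert (p α s : ℝ) : ℝ := (p + 1) / α ^ (p + 1) * (sinPot α - sinPot (α * s))

/-- The oscillating part of `pert`, see `pert_eq`. -/
def ripple (α s : ℝ) : ℝ :=
  (sin (2 * α) - s * sin (2 * α * s)) / α + (cos (2 * α) - cos (2 * α * s)) / (2 * α ^ 2)

/-- The time map at the maximum `α`, rescaled to the unit interval. -/
def normTime (p α : ℝ) : ℝ := ∫ s in (0 : ℝ)..1, 1 / √(gap p s + pert p α s)

/-- The integral of the velocity `√(F α - F y)` over `[0, α]`, rescaled to the unit interval. -/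
def normVel (p α : ℝ) : ℝ := ∫ s in (0 : ℝ)..1, √(gap p s + pert p α s)

section sinPot

lemma hasDerivAt_sinPot (u : ℝ) : HasDerivAt sinPot (u * sin u ^ 2) u := by
  have hlin : HasDerivAt (fun u : ℝ => 2 * u) 2 u := by simpa using (hasDerivAt_id u).const_mul 2
  refine (((((hasDerivAt_id u).pow 2).div_const 4).sub
    (((hasDerivAt_id u).mul hlin.sin).div_const 4)).sub
    (hlin.cos.div_const 8)).add_const (1 / 8) |>.congr_deriv ?_
  simp only [id, Real.sin_sq_eq_half_sub]
  push_cast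
  ring

lemma continuous_sinPot : Continuous sinPot :=
  continuous_iff_continuousAt.2 fun u => (hasDerivAt_sinPot u).continuousAt

lemma monotoneOn_sinPot : MonotoneOn sinPot (Ici 0) := by
  refine monotoneOn_of_hasDerivWithinAt_nonneg (convex_Ici 0) continuous_sinPot.continuousOn
    (fun u _ => (hasDerivAt_sinPot u).hasDerivWithinAt) fun u hu => ?_
  rw [interior_Ici] at hu
  exact mul_nonneg hu.le (sq_nonneg _)

lemma monotoneOn_sq_div_two_sub_sinPot :
    MonotoneOn (fun u : ℝ => u ^ 2 / 2 - sinPot u) (Ici 0) := by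
  have hderiv (u : ℝ) : HasDerivAt (fun u => u ^ 2 / 2 - sinPot u) (u * (1 - sin u ^ 2)) u := by
    refine (((hasDerivAt_id u).pow 2).div_const 2).sub (hasDerivAt_sinPot u) |>.congr_deriv ?_
    simp only [id]
    push_cast
    ring
  refine monotoneOn_of_hasDerivWithinAt_nonneg (convex_Ici 0)
    (fun u _ => (hderiv u).continuousAt.continuousWithinAt)
    (fun u _ => (hderiv u).hasDerivWithinAt) fun u hu => ?_
  rw [interior_Ici] at hu
  exact mul_nonneg hu.le (sub_nonneg.2 (Real.sin_sq_le_one u))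

end sinPot

section potentialDifference

variable {p α s : ℝ}

lemma sinPot_sub_sinPot_mul (hα : α ≠ 0) (s : ℝ) :
    sinPot α - sinPot (α * s) = α ^ 2 / 4 * ((1 - s ^ 2) - ripple α s) := by
  unfold sinPot ripple
  rw [← mul_assoc 2 α s]
  field_simp
  ring

lemma abs_ripple_le (hα : 0 < α) (hs : s ∈ Icc (0 : ℝ) 1) : |ripple α s| ≤ 1 - s ^ 2 := by
  have hαs : 0 ≤ α * s := mul_nonneg hα.le hs.1
  have hle : α * s ≤ α := mul_le_of_le_one_right hα.le hs.2
  have hlower := monotoneOn_sinPot hαs hα.le hle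
  have hupper := monotoneOn_sq_div_two_sub_sinPot hαs hα.le hle
  have hdiff := sinPot_sub_sinPot_mul hα.ne' s
  have hk : 0 < α ^ 2 / 4 := by positivity
  refine abs_le.2 ⟨le_of_mul_le_mul_left (a := α ^ 2 / 4) ?_ hk,
    le_of_mul_le_mul_left (a := α ^ 2 / 4) ?_ hk⟩
  · linear_combination hupper - hdiff
  · linear_combination hlower + hdiff

lemma rpow_one_sub_eq (hα : 0 < α) : α ^ (1 - p) = α ^ 2 / α ^ (p + 1) := by
  rw [show 1 - p = 2 - (p + 1) by ring, rpow_sub hα, rpow_two]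

lemma pert_eq (hα : 0 < α) (s : ℝ) :
    pert p α s = (p + 1) / 4 * α ^ (1 - p) * ((1 - s ^ 2) - ripple α s) := by
  rw [pert, sinPot_sub_sinPot_mul hα.ne', rpow_one_sub_eq hα]
  ring

lemma one_sub_sq_le_gap (hp : 1 ≤ p) (hs : s ∈ Icc (0 : ℝ) 1) : 1 - s ^ 2 ≤ gap p s := by
  rw [gap, ← rpow_two]
  exact sub_le_sub_left
    (rpow_le_rpow_of_exponent_ge' hs.1 hs.2 zero_le_two (by linarith)) 1

lemma one_sub_le_gap (hp : 0 ≤ p) (hs : s ∈ Icc (0 : ℝ) 1) : 1 - s ≤ gap p s := by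
  rw [gap]
  simpa only [rpow_one] using sub_le_sub_left
    (rpow_le_rpow_of_exponent_ge' hs.1 hs.2 zero_le_one (le_add_of_nonneg_left hp)) 1

lemma gap_pos (hp : 0 ≤ p) (hs : s ∈ Ico (0 : ℝ) 1) : 0 < gap p s :=
  (sub_pos.2 hs.2).trans_le (one_sub_le_gap hp ⟨hs.1, hs.2.le⟩)

lemma gap_le_one (hs : 0 ≤ s) : gap p s ≤ 1 :=
  sub_le_self _ (rpow_nonneg hs _)

lemma measurable_gap (p : ℝ) : Measurable (gap p) := by
  unfold gap
  fun_prop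

lemma measurable_ripple (α : ℝ) : Measurable (ripple α) := by
  unfold ripple
  fun_prop

lemma measurable_pert (p α : ℝ) : Measurable (pert p α) := by
  unfold pert sinPot
  fun_prop

lemma pert_nonneg (hp : 0 ≤ p) (hα : 0 < α) (hs : s ∈ Icc (0 : ℝ) 1) : 0 ≤ pert p α s := by
  have hle : α * s ≤ α := mul_le_of_le_one_right hα.le hs.2
  have hsub : 0 ≤ sinPot α - sinPot (α * s) :=
    sub_nonneg.2 (monotoneOn_sinPot (mul_nonneg hα.le hs.1) hα.le hle)
  have : 0 < α ^ (p + 1) := rpow_pos_of_pos hα _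
  unfold pert
  positivity

lemma pert_le (hp : 1 ≤ p) (hα : 0 < α) (hs : s ∈ Icc (0 : ℝ) 1) :
    pert p α s ≤ (p + 1) / 2 * α ^ (1 - p) * gap p s := by
  have hripple := (abs_le.1 (abs_ripple_le hα hs)).1
  have hgap := one_sub_sq_le_gap hp hs
  have : 0 < α ^ (1 - p) := rpow_pos_of_pos hα _
  calc pert p α s = (p + 1) / 4 * α ^ (1 - p) * ((1 - s ^ 2) - ripple α s) := pert_eq hα s
    _ ≤ (p + 1) / 4 * α ^ (1 - p) * (2 * gap p s) := by gcongr; linarith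
    _ = (p + 1) / 2 * α ^ (1 - p) * gap p s := by ring

lemma hasDerivAt_sourcePot (hp : 0 ≤ p) (u : ℝ) : HasDerivAt (sourcePot p) (source p u) u := by
  refine ((Real.hasDerivAt_rpow_const (Or.inr (le_add_of_nonneg_left hp))).div_const (p + 1)).add
    (hasDerivAt_sinPot u) |>.congr_deriv ?_
  have : p + 1 ≠ 0 := by positivity
  rw [add_sub_cancel_right, source]
  field_simp

lemma sqrt_sourcePot_sub (hp : 0 ≤ p) (hα : 0 < α) (hs : 0 ≤ s) :
    √(sourcePot p α - sourcePot p (α * s)) =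
      √(α ^ (p + 1) / (p + 1)) * √(gap p s + pert p α s) := by
  have : 0 < α ^ (p + 1) := rpow_pos_of_pos hα _
  rw [← Real.sqrt_mul (by positivity)]
  congr 1
  unfold sourcePot gap pert
  rw [mul_rpow hα.le hs]
  field_simp
  ring

end potentialDifference

section normTime

variable {p α : ℝ}

lemma intervalIntegrable_one_div_sqrt_one_sub :
    IntervalIntegrable (fun s : ℝ => 1 / √(1 - s)) volume 0 1 := by
  have h : IntervalIntegrable (fun x : ℝ => x ^ (-(1 / 2) : ℝ)) volume 0 1 :=
    intervalIntegrable_rpow' (by norm_num)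
  have h := (h.comp_sub_left 1).symm
  simp only [sub_zero, sub_self] at h
  refine h.congr fun s hs => ?_
  rw [uIoc_of_le zero_le_one] at hs
  rw [rpow_neg (sub_nonneg.2 hs.2), ← Real.sqrt_eq_rpow, one_div]

lemma intervalIntegrable_of_abs_le_div_sqrt_one_sub {φ : ℝ → ℝ} {C : ℝ}
    (hm : AEStronglyMeasurable φ (volume.restrict (Ioo 0 1)))
    (hb : ∀ s ∈ Ioo (0 : ℝ) 1, |φ s| ≤ C * (1 / √(1 - s))) :
    IntervalIntegrable φ volume 0 1 := by
  have hC := intervalIntegrable_one_div_sqrt_one_sub.const_mul C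
  rw [intervalIntegrable_iff_integrableOn_Ioo_of_le zero_le_one] at hC ⊢
  exact Integrable.mono' hC hm (ae_restrict_of_forall_mem measurableSet_Ioo hb)

lemma integral_eq_mul_integral_comp_mul (f : ℝ → ℝ) (c : ℝ) :
    ∫ y in (0 : ℝ)..c, f y = c * ∫ s in (0 : ℝ)..1, f (c * s) := by
  rw [mul_integral_comp_mul_left, mul_zero, mul_one]

lemma intervalIntegrable_one_div_sqrt_sourcePot_sub (hp : 0 ≤ p) (hα : 0 < α) :
    IntervalIntegrable (fun y => 1 / √(sourcePot p α - sourcePot p y)) volume 0 α := by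
  have hcont : Continuous (sourcePot p) :=
    continuous_iff_continuousAt.2 fun u => (hasDerivAt_sourcePot hp u).continuousAt
  have hscaled : IntervalIntegrable
      (fun s => 1 / √(sourcePot p α - sourcePot p (α * s))) volume 0 1 := by
    refine intervalIntegrable_of_abs_le_div_sqrt_one_sub (C := 1 / √(α ^ (p + 1) / (p + 1)))
      (Measurable.aestronglyMeasurable ?_) fun s hs => ?_
    · exact (continuous_const.sub
        (hcont.comp (continuous_const.mul continuous_id))).sqrt.measurable.const_div 1
    · have hle : 1 - s ≤ gap p s + pert p α s :=
        le_add_of_le_of_nonneg (one_sub_le_gap hp (Ioo_subset_Icc_self hs))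
          (pert_nonneg hp hα (Ioo_subset_Icc_self hs))
      have : 0 < √(1 - s) := Real.sqrt_pos.2 (sub_pos.2 hs.2)
      rw [sqrt_sourcePot_sub hp hα hs.1.le, abs_of_nonneg (by positivity), ← one_div_mul_one_div]
      gcongr
  have hrescaled := hscaled.comp_mul_left (c := α⁻¹)
  simp only [zero_div, one_div, inv_inv] at hrescaled
  refine hrescaled.congr fun s _ => ?_
  simp only [one_div, mul_inv_cancel_left₀ hα.ne']

lemma isPotential_sourcePot (hp : 0 ≤ p) (hα : 0 < α) :
    IsPotential (source p) (sourcePot p) α where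
  continuous := by
    have : Continuous fun u : ℝ => u ^ p := Real.continuous_rpow_const hp
    unfold source
    fun_prop
  pos u hu := by
    have := rpow_pos_of_pos hu p
    unfold source
    positivity
  hasDerivAt := hasDerivAt_sourcePot hp
  amplitude_pos := hα
  intervalIntegrable := intervalIntegrable_one_div_sqrt_sourcePot_sub hp hα

lemma timeMap_sourcePot (hp : 0 ≤ p) (hα : 0 < α) :
    timeMap (sourcePot p) α α = α * (normTime p α / √(α ^ (p + 1) / (p + 1))) := by
  rw [timeMap_amplitude hα.le, integral_eq_mul_integral_comp_mul, normTime,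
    ← intervalIntegral.integral_div]
  congr 1
  refine integral_congr_Ioo_of_le zero_le_one fun s hs => ?_
  rw [sqrt_sourcePot_sub hp hα hs.1.le, div_div, mul_comm]

lemma integral_sqrt_sourcePot_sub (hp : 0 ≤ p) (hα : 0 < α) :
    ∫ y in (0 : ℝ)..α, √(sourcePot p α - sourcePot p y) =
      α * (√(α ^ (p + 1) / (p + 1)) * normVel p α) := by
  rw [integral_eq_mul_integral_comp_mul, normVel, ← intervalIntegral.integral_const_mul (√_)]
  congr 1
  exact integral_congr_Ioo_of_le zero_le_one fun s hs => sqrt_sourcePot_sub hp hα hs.1.le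

lemma two_mul_timeMap_sq (hp : 0 ≤ p) (hα : 0 < α) :
    2 * timeMap (sourcePot p) α α ^ 2 = 2 * (p + 1) * α ^ (1 - p) * normTime p α ^ 2 := by
  have : 0 < α ^ (p + 1) := rpow_pos_of_pos hα _
  rw [timeMap_sourcePot hp hα, mul_pow, div_pow, Real.sq_sqrt (by positivity), rpow_one_sub_eq hα]
  field_simp

lemma energy_solution_sourcePot (hp : 0 ≤ p) (hα : 0 < α) :
    energy (isPotential_sourcePot hp hα).solution =
      4 * α ^ 2 * (normTime p α * normVel p α) := by
  have : 0 < α ^ (p + 1) := rpow_pos_of_pos hα _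
  have : 0 < √(α ^ (p + 1) / (p + 1)) := Real.sqrt_pos.2 (by positivity)
  rw [IsPotential.energy_solution, timeMap_sourcePot hp hα, integral_sqrt_sourcePot_sub hp hα]
  field_simp

end normTime

/-- The integral `∫₀¹ φ(s) (1 - s^{p+1})^{-n-1/2} ds`, the form into which all the coefficients of
the expansion are brought. -/
def gapInt (p : ℝ) (n : ℕ) (φ : ℝ → ℝ) : ℝ :=
  ∫ s in (0 : ℝ)..1, φ s / (gap p s ^ n * √(gap p s))

/-- `φ` is measurable and `O((1 - s^{p+1})^n)` on `(0,1)`, so that `gapInt p n φ` converges. -/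
def GapBounded (p : ℝ) (n : ℕ) (φ : ℝ → ℝ) : Prop :=
  Measurable φ ∧ ∃ C, ∀ s ∈ Ioo (0 : ℝ) 1, |φ s| ≤ C * gap p s ^ n

section gapInt

variable {p C : ℝ} {m n : ℕ} {φ ψ : ℝ → ℝ}

lemma gapInt_congr (h : EqOn φ ψ (Ioo 0 1)) : gapInt p n φ = gapInt p n ψ :=
  integral_congr_Ioo_of_le zero_le_one fun s hs => by rw [h hs]

lemma gap_pos_of_mem_Ioo (hp : 0 ≤ p) {s : ℝ} (hs : s ∈ Ioo (0 : ℝ) 1) : 0 < gap p s :=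
  gap_pos hp (Ioo_subset_Ico_self hs)

lemma sqrt_gap_pos (hp : 0 ≤ p) {s : ℝ} (hs : s ∈ Ioo (0 : ℝ) 1) : 0 < √(gap p s) :=
  Real.sqrt_pos.2 (gap_pos_of_mem_Ioo hp hs)

lemma continuous_gap (hp : 0 ≤ p) : Continuous (gap p) :=
  continuous_const.sub (Real.continuous_rpow_const (by positivity))

lemma intervalIntegrable_of_abs_le_div_sqrt_gap (hp : 0 ≤ p) (hm : Measurable φ)
    (hb : ∀ s ∈ Ioo (0 : ℝ) 1, |φ s| ≤ C * (1 / √(gap p s))) :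
    IntervalIntegrable φ volume 0 1 := by
  refine intervalIntegrable_of_abs_le_div_sqrt_one_sub (C := |C|) hm.aestronglyMeasurable
    fun s hs => (hb s hs).trans ?_
  have : 0 < √(1 - s) := Real.sqrt_pos.2 (sub_pos.2 hs.2)
  have hgap := one_sub_le_gap hp (Ioo_subset_Icc_self hs)
  calc C * (1 / √(gap p s)) ≤ |C| * (1 / √(gap p s)) := by gcongr; exact le_abs_self C
    _ ≤ |C| * (1 / √(1 - s)) := by gcongr

lemma abs_div_gap_le (hp : 0 ≤ p) {s x : ℝ} (hs : s ∈ Ioo (0 : ℝ) 1)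
    (hb : |x| ≤ C * gap p s ^ n) :
    |x / (gap p s ^ n * √(gap p s))| ≤ C * (1 / √(gap p s)) := by
  have hgap := gap_pos_of_mem_Ioo hp hs
  have := sqrt_gap_pos hp hs
  calc |x / (gap p s ^ n * √(gap p s))| = |x| / (gap p s ^ n * √(gap p s)) := by
        rw [abs_div, abs_of_pos (a := _ * _) (by positivity)]
    _ ≤ C * gap p s ^ n / (gap p s ^ n * √(gap p s)) := by gcongr
    _ = C * (1 / √(gap p s)) := by field_simp

namespace GapBounded

lemma intervalIntegrable (h : GapBounded p n φ) (hp : 0 ≤ p) :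
    IntervalIntegrable (fun s => φ s / (gap p s ^ n * √(gap p s))) volume 0 1 := by
  obtain ⟨hm, C, hC⟩ := h
  have := measurable_gap p
  exact intervalIntegrable_of_abs_le_div_sqrt_gap hp (by fun_prop)
    fun s hs => abs_div_gap_le hp hs (hC s hs)

lemma const_mul (h : GapBounded p n φ) (c : ℝ) : GapBounded p n fun s => c * φ s := by
  obtain ⟨hm, C, hC⟩ := h
  refine ⟨hm.const_mul c, |c| * C, fun s hs => ?_⟩
  rw [abs_mul, mul_assoc]
  exact mul_le_mul_of_nonneg_left (hC s hs) (abs_nonneg c)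

lemma add (h : GapBounded p n φ) (h' : GapBounded p n ψ) :
    GapBounded p n fun s => φ s + ψ s := by
  obtain ⟨hm, C, hC⟩ := h
  obtain ⟨hm', C', hC'⟩ := h'
  refine ⟨hm.add hm', C + C', fun s hs => ?_⟩
  rw [add_mul]
  exact (abs_add_le _ _).trans (add_le_add (hC s hs) (hC' s hs))

lemma sub (h : GapBounded p n φ) (h' : GapBounded p n ψ) :
    GapBounded p n fun s => φ s - ψ s := by
  simpa only [sub_eq_add_neg, neg_one_mul] using h.add (h'.const_mul (-1))

lemma mul (h : GapBounded p m φ) (h' : GapBounded p n ψ) :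
    GapBounded p (m + n) fun s => φ s * ψ s := by
  obtain ⟨hm, C, hC⟩ := h
  obtain ⟨hm', C', hC'⟩ := h'
  refine ⟨hm.mul hm', C * C', fun s hs => ?_⟩
  rw [abs_mul, pow_add, mul_mul_mul_comm]
  exact mul_le_mul (hC s hs) (hC' s hs) (abs_nonneg _) ((abs_nonneg _).trans (hC s hs))

lemma sq (h : GapBounded p n φ) : GapBounded p (2 * n) fun s => φ s ^ 2 := by
  simpa only [pow_two, two_mul] using h.mul h

lemma mono (h : GapBounded p n φ) (hp : 0 ≤ p) (hmn : m ≤ n) : GapBounded p m φ := by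
  obtain ⟨hm, C, hC⟩ := h
  refine ⟨hm, |C|, fun s hs => (hC s hs).trans ?_⟩
  have := gap_pos_of_mem_Ioo hp hs
  calc C * gap p s ^ n ≤ |C| * gap p s ^ n := by gcongr; exact le_abs_self C
    _ ≤ |C| * gap p s ^ m := mul_le_mul_of_nonneg_left
        (pow_le_pow_of_le_one this.le (gap_le_one hs.1.le) hmn) (abs_nonneg C)

end GapBounded

lemma gapBounded_zero_of_abs_le (hm : Measurable φ) (hb : ∀ s ∈ Ioo (0 : ℝ) 1, |φ s| ≤ C) :
    GapBounded p 0 φ :=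
  ⟨hm, C, fun s hs => by simpa only [pow_zero, mul_one] using hb s hs⟩

lemma gapBounded_one_of_abs_le (hp : 0 ≤ p) (hC : 0 ≤ C) (hm : Measurable φ)
    (hb : ∀ s ∈ Ioo (0 : ℝ) 1, |φ s| ≤ C * (1 - s)) : GapBounded p 1 φ :=
  ⟨hm, C, fun s hs => by
    rw [pow_one]
    exact (hb s hs).trans
      (mul_le_mul_of_nonneg_left (one_sub_le_gap hp (Ioo_subset_Icc_self hs)) hC)⟩

lemma gapBounded_one_sub_sq (hp : 0 ≤ p) : GapBounded p 1 fun s => 1 - s ^ 2 :=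
  gapBounded_one_of_abs_le hp zero_le_two (by fun_prop) fun s hs => by
    rw [abs_of_nonneg (sub_nonneg.2 (pow_le_one₀ hs.1.le hs.2.le))]
    linarith [sq_nonneg (1 - s)]

lemma gapBounded_ripple (hp : 1 ≤ p) {α : ℝ} (hα : 0 < α) : GapBounded p 1 (ripple α) :=
  ⟨measurable_ripple α, 1, fun s hs => by
    rw [pow_one, one_mul]
    exact (abs_ripple_le hα (Ioo_subset_Icc_self hs)).trans
      (one_sub_sq_le_gap hp (Ioo_subset_Icc_self hs))⟩

lemma gapInt_const_mul (c : ℝ) (φ : ℝ → ℝ) :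
    gapInt p n (fun s => c * φ s) = c * gapInt p n φ := by
  unfold gapInt
  rw [← intervalIntegral.integral_const_mul]
  simp only [mul_div_assoc]

lemma gapInt_add (hp : 0 ≤ p) (h : GapBounded p n φ) (h' : GapBounded p n ψ) :
    gapInt p n (fun s => φ s + ψ s) = gapInt p n φ + gapInt p n ψ := by
  unfold gapInt
  rw [← intervalIntegral.integral_add (h.intervalIntegrable hp) (h'.intervalIntegrable hp)]
  simp only [add_div]

lemma gapInt_sub (hp : 0 ≤ p) (h : GapBounded p n φ) (h' : GapBounded p n ψ) :
    gapInt p n (fun s => φ s - ψ s) = gapInt p n φ - gapInt p n ψ := by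
  unfold gapInt
  rw [← intervalIntegral.integral_sub (h.intervalIntegrable hp) (h'.intervalIntegrable hp)]
  simp only [sub_div]

lemma intervalIntegrable_one_div_sqrt_gap (hp : 0 ≤ p) :
    IntervalIntegrable (fun s => 1 / √(gap p s)) volume 0 1 := by
  have := measurable_gap p
  refine intervalIntegrable_of_abs_le_div_sqrt_gap (C := 1) hp (by fun_prop) fun s _ => ?_
  rw [one_mul, abs_of_nonneg (by positivity)]

lemma abs_integral_le_mul_C0 (hp : 0 ≤ p)
    (hb : ∀ s ∈ Ioo (0 : ℝ) 1, |φ s| ≤ C * (1 / √(gap p s))) :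
    |∫ s in (0 : ℝ)..1, φ s| ≤ C * C0 p := by
  have hC0 : C * C0 p = ∫ s in (0 : ℝ)..1, C * (1 / √(gap p s)) :=
    (intervalIntegral.integral_const_mul _ _).symm
  have hint := (intervalIntegrable_one_div_sqrt_gap hp).const_mul C
  rw [intervalIntegrable_iff_integrableOn_Ioo_of_le zero_le_one] at hint
  rw [hC0, ← Real.norm_eq_abs, integral_of_le zero_le_one, integral_of_le zero_le_one,
    integral_Ioc_eq_integral_Ioo, integral_Ioc_eq_integral_Ioo]
  exact norm_integral_le_of_norm_le hint (ae_restrict_of_forall_mem measurableSet_Ioo hb)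

lemma abs_gapInt_le (hp : 0 ≤ p) (hb : ∀ s ∈ Ioo (0 : ℝ) 1, |φ s| ≤ C * gap p s ^ n) :
    |gapInt p n φ| ≤ C * C0 p :=
  abs_integral_le_mul_C0 hp fun s hs => abs_div_gap_le hp hs (hb s hs)

lemma C0_pos (hp : 0 ≤ p) : 0 < C0 p :=
  intervalIntegral_pos_of_pos_on (intervalIntegrable_one_div_sqrt_gap hp)
    (fun _ hs => one_div_pos.2 (sqrt_gap_pos hp hs)) one_pos

end gapInt

section coefficients

variable {p : ℝ}

lemma rpow_three_halves {x : ℝ} (hx : 0 ≤ x) : x ^ (3 / 2 : ℝ) = x ^ 1 * √x := by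
  rw [Real.sqrt_eq_rpow, show (3 / 2 : ℝ) = 1 + 1 / 2 by norm_num,
    rpow_add_of_nonneg hx zero_le_one one_half_pos.le, rpow_one, pow_one]

lemma rpow_five_halves {x : ℝ} (hx : 0 ≤ x) : x ^ (5 / 2 : ℝ) = x ^ 2 * √x := by
  rw [Real.sqrt_eq_rpow, show (5 / 2 : ℝ) = 2 + 1 / 2 by norm_num,
    rpow_add_of_nonneg hx zero_le_two one_half_pos.le, rpow_two]

lemma integral_div_rpow_three_halves (hp : 0 ≤ p) (φ : ℝ → ℝ) :
    ∫ s in (0 : ℝ)..1, φ s / (1 - s ^ (p + 1)) ^ (3 / 2 : ℝ) = gapInt p 1 φ :=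
  integral_congr_Ioo_of_le zero_le_one fun s hs => by
    rw [← gap, rpow_three_halves (gap_pos_of_mem_Ioo hp hs).le]

lemma integral_div_rpow_five_halves (hp : 0 ≤ p) (φ : ℝ → ℝ) :
    ∫ s in (0 : ℝ)..1, φ s / (1 - s ^ (p + 1)) ^ (5 / 2 : ℝ) = gapInt p 2 φ :=
  integral_congr_Ioo_of_le zero_le_one fun s hs => by
    rw [← gap, rpow_five_halves (gap_pos_of_mem_Ioo hp hs).le]

lemma C1_eq (hp : 0 ≤ p) : C1 p = -((p + 1) / 8) * gapInt p 1 fun s => 1 - s ^ 2 := by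
  rw [C1, integral_div_rpow_three_halves hp]

lemma C2_eq (hp : 0 ≤ p) :
    C2 p = 3 * (p + 1) ^ 2 / 128 * gapInt p 2 fun s => (1 - s ^ 2) ^ 2 := by
  rw [C2, integral_div_rpow_five_halves hp fun s => (1 - s ^ 2) ^ 2]

lemma E1_eq (p : ℝ) : E1 p = (p + 1) / 8 * gapInt p 0 fun s => 1 - s ^ 2 := by
  simp only [E1, gapInt, gap, pow_zero, one_mul]

lemma E4_eq (hp : 0 ≤ p) :
    E4 p = -((p + 1) ^ 2 / 128) * gapInt p 1 fun s => (1 - s ^ 2) ^ 2 := by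
  rw [E4, integral_div_rpow_three_halves hp fun s => (1 - s ^ 2) ^ 2]

lemma sin_pos_of_mem_Ioo_pi_div_two {θ : ℝ} (hθ : θ ∈ Ioo (0 : ℝ) (π / 2)) : 0 < sin θ :=
  sin_pos_of_pos_of_lt_pi hθ.1 (hθ.2.trans (half_lt_self pi_pos))

lemma image_sin_rpow_Ioo {q : ℝ} (hq : 0 < q) :
    (fun θ => sin θ ^ q) '' Ioo 0 (π / 2) = Ioo 0 1 := by
  ext s
  constructor
  · rintro ⟨θ, hθ, rfl⟩
    have hsin := sin_pos_of_mem_Ioo_pi_div_two hθ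
    have hlt : sin θ < 1 := by
      rw [← sin_pi_div_two]
      exact sin_lt_sin_of_lt_of_le_pi_div_two (by linarith [hθ.1, pi_pos]) le_rfl hθ.2
    exact ⟨rpow_pos_of_pos hsin _, rpow_lt_one hsin.le hlt hq⟩
  · intro hs
    have hpos : 0 < s ^ q⁻¹ := rpow_pos_of_pos hs.1 _
    have hlt : s ^ q⁻¹ < 1 := rpow_lt_one hs.1.le hs.2 (inv_pos.2 hq)
    refine ⟨arcsin (s ^ q⁻¹), ⟨arcsin_pos.2 hpos, arcsin_lt_pi_div_two.2 hlt⟩, ?_⟩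
    simp only [sin_arcsin (neg_one_lt_zero.trans hpos).le hlt.le, rpow_inv_rpow hs.1.le hq.ne']

lemma monotoneOn_sin_rpow {q : ℝ} (hq : 0 ≤ q) :
    MonotoneOn (fun θ => sin θ ^ q) (Ioo 0 (π / 2)) := fun a ha b hb hab =>
  rpow_le_rpow (sin_pos_of_mem_Ioo_pi_div_two ha).le
    (sin_le_sin_of_le_of_le_pi_div_two (by linarith [ha.1, pi_pos]) hb.2.le hab) hq

lemma gap_sin_rpow (hp : -1 < p) {θ : ℝ} (hθ : θ ∈ Ioo (0 : ℝ) (π / 2)) :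
    gap p (sin θ ^ (2 / (p + 1))) = cos θ ^ 2 := by
  have : p + 1 ≠ 0 := by linarith
  rw [gap, ← rpow_mul (sin_pos_of_mem_Ioo_pi_div_two hθ).le, div_mul_cancel₀ _ this, rpow_two,
    cos_sq']

/-- The substitution `s = sin^{2/(p+1)} θ`. -/
lemma integral_comp_sin_rpow (hp : -1 < p) (k : ℝ → ℝ) :
    ∫ θ in (0 : ℝ)..(π / 2), k (sin θ ^ (2 / (p + 1))) * sin θ ^ ((1 - p) / (p + 1)) =
      (p + 1) / 2 * gapInt p 0 k := by
  have hq : 0 < p + 1 := by linarith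
  have hderiv : ∀ θ ∈ Ioo (0 : ℝ) (π / 2), HasDerivWithinAt (fun θ => sin θ ^ (2 / (p + 1)))
      (cos θ * (2 / (p + 1)) * sin θ ^ ((1 - p) / (p + 1))) (Ioo 0 (π / 2)) θ := by
    intro θ hθ
    have := (Real.hasDerivAt_sin θ).rpow_const (p := 2 / (p + 1))
      (Or.inl (sin_pos_of_mem_Ioo_pi_div_two hθ).ne')
    rw [show 2 / (p + 1) - 1 = (1 - p) / (p + 1) by field_simp; ring] at this
    exact this.hasDerivWithinAt
  have hsubst := integral_image_eq_integral_deriv_smul_of_monotoneOn measurableSet_Ioo hderiv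
    (monotoneOn_sin_rpow (by positivity)) (fun s => k s / (gap p s ^ 0 * √(gap p s)))
  rw [image_sin_rpow_Ioo (by positivity)] at hsubst
  rw [gapInt, integral_of_le zero_le_one, integral_of_le (by positivity),
    integral_Ioc_eq_integral_Ioo, integral_Ioc_eq_integral_Ioo, hsubst,
    ← MeasureTheory.integral_const_mul]
  refine setIntegral_congr_fun measurableSet_Ioo fun θ hθ => ?_
  have hcos : 0 < cos θ := cos_pos_of_mem_Ioo ⟨by linarith [hθ.1, pi_pos], hθ.2⟩
  simp only [gap_sin_rpow hp hθ, Real.sqrt_sq hcos.le, pow_zero, one_mul, smul_eq_mul]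
  field_simp

lemma sin_rpow_mul_sin_rpow {θ : ℝ} (hθ : θ ∈ Ioo (0 : ℝ) (π / 2)) :
    sin θ ^ (2 / (p + 1)) * sin θ ^ ((1 - p) / (p + 1)) = sin θ ^ ((3 - p) / (p + 1)) := by
  rw [← rpow_add (sin_pos_of_mem_Ioo_pi_div_two hθ)]
  congr 1
  ring

lemma integral_comp_sin_rpow_mul (hp : -1 < p) (k : ℝ → ℝ) :
    ∫ θ in (0 : ℝ)..(π / 2), k (sin θ ^ (2 / (p + 1))) * sin θ ^ ((3 - p) / (p + 1)) =
      (p + 1) / 2 * gapInt p 0 fun s => s * k s := by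
  rw [← integral_comp_sin_rpow hp]
  refine integral_congr_Ioo_of_le (by positivity) fun θ hθ => ?_
  rw [← sin_rpow_mul_sin_rpow hθ]
  ring

lemma C11_eq (hp : -1 < p) (α : ℝ) : C11 p α = gapInt p 0 fun s => s * cos (2 * α * s) := by
  have : p + 1 ≠ 0 := by linarith
  rw [C11, integral_comp_sin_rpow_mul hp fun s => cos (2 * α * s), ← mul_assoc,
    div_mul_div_cancel₀ this, div_self two_ne_zero, one_mul]

lemma C12_eq (hp : 0 ≤ p) (α : ℝ) :
    C12 p α = (p - 1) / 4 * (gapInt p 0 fun s => sin (2 * α) - sin (2 * α * s)) +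
      (p + 1) / 4 * gapInt p 1 fun s => (1 - s) * sin (2 * α * s) := by
  rw [C12, integral_comp_sin_rpow (by linarith) fun s => sin (2 * α) - sin (2 * α * s),
    ← integral_div_rpow_three_halves hp]
  simp only [div_mul_eq_mul_div]
  field_simp
  ring

lemma C21_eq (hp : -1 < p) (α : ℝ) :
    C21 p α = -(1 / 2) * gapInt p 0 fun s => s * sin (2 * α * s) := by
  have : p + 1 ≠ 0 := by linarith
  rw [C21, integral_comp_sin_rpow_mul hp fun s => sin (2 * α * s), ← mul_assoc, neg_mul,
    div_mul_div_cancel₀ this]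

lemma C22_eq (hp : -1 < p) (α : ℝ) :
    C22 p α = (p - 1) / 8 * gapInt p 0 fun s => cos (2 * α) - cos (2 * α * s) := by
  have : p + 1 ≠ 0 := by linarith
  rw [C22, integral_comp_sin_rpow hp fun s => cos (2 * α) - cos (2 * α * s)]
  field_simp
  ring

lemma E2_eq (hp : -1 < p) (α : ℝ) :
    E2 p α = -((p + 1) / 8) * gapInt p 0 fun s => sin (2 * α) - s * sin (2 * α * s) := by
  rw [E2, integral_comp_sin_rpow hp fun s => sin (2 * α) - s * sin (2 * α * s)]
  ring

lemma E3_eq (hp : -1 < p) (α : ℝ) :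
    E3 p α = -((p + 1) / 16) * gapInt p 0 fun s => cos (2 * α) - cos (2 * α * s) := by
  rw [E3, integral_comp_sin_rpow hp fun s => cos (2 * α) - cos (2 * α * s)]
  ring

end coefficients

section integrationByParts

variable {p L : ℝ} {k k' : ℝ → ℝ}

/-- The boundary term `(k(1) - k(s)) s / √(1 - s^{p+1})` in the integration by parts of
`gapInt_one_sub_eq`. -/
def boundaryTerm (p : ℝ) (k : ℝ → ℝ) (s : ℝ) : ℝ := (k 1 - k s) * s / √(gap p s)

lemma abs_sub_le_mul_one_sub (hk : ∀ s, HasDerivAt k (k' s) s) (hL : ∀ s, |k' s| ≤ L) {s : ℝ}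
    (hs : s ≤ 1) : |k 1 - k s| ≤ L * (1 - s) := by
  have := convex_univ.norm_image_sub_le_of_norm_hasDerivWithin_le (f := k) (f' := k') (C := L)
    (fun x _ => (hk x).hasDerivWithinAt) (fun x _ => hL x) (mem_univ s) (mem_univ (1 : ℝ))
  rwa [Real.norm_eq_abs, Real.norm_eq_abs, abs_of_nonneg (sub_nonneg.2 hs)] at this

lemma gapBounded_one_sub (hp : 0 ≤ p) (hk : ∀ s, HasDerivAt k (k' s) s) (hL : ∀ s, |k' s| ≤ L) :
    GapBounded p 1 fun s => k 1 - k s := by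
  have hcont : Continuous k := continuous_iff_continuousAt.2 fun s => (hk s).continuousAt
  exact gapBounded_one_of_abs_le hp ((abs_nonneg _).trans (hL 0)) (by fun_prop)
    fun s hs => abs_sub_le_mul_one_sub hk hL hs.2.le

lemma boundaryTerm_one (p : ℝ) (k : ℝ → ℝ) : boundaryTerm p k 1 = 0 := by
  rw [boundaryTerm, sub_self, zero_mul, zero_div]

lemma abs_boundaryTerm_le (hp : 0 ≤ p) (hk : ∀ s, HasDerivAt k (k' s) s)
    (hL : ∀ s, |k' s| ≤ L) {s : ℝ} (hs : s ∈ Icc (0 : ℝ) 1) :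
    |boundaryTerm p k s| ≤ L * √(1 - s) := by
  rcases hs.2.eq_or_lt with rfl | hs1
  · simp only [boundaryTerm_one, abs_zero, sub_self, Real.sqrt_zero, mul_zero, le_refl]
  have hL0 : 0 ≤ L := (abs_nonneg _).trans (hL 0)
  have hs1 : 0 < 1 - s := sub_pos.2 hs1
  have hsqrt : √(1 - s) ≤ √(gap p s) := Real.sqrt_le_sqrt (one_sub_le_gap hp hs)
  have hpos : 0 < √(1 - s) := Real.sqrt_pos.2 hs1
  rw [boundaryTerm, abs_div, abs_mul, abs_of_nonneg (Real.sqrt_nonneg (gap p s)),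
    abs_of_nonneg hs.1, div_le_iff₀ (hpos.trans_le hsqrt)]
  calc |k 1 - k s| * s ≤ L * (1 - s) * 1 :=
        mul_le_mul (abs_sub_le_mul_one_sub hk hL hs.2) hs.2 hs.1 (mul_nonneg hL0 hs1.le)
    _ = L * √(1 - s) * √(1 - s) := by rw [mul_one, mul_assoc L, Real.mul_self_sqrt hs1.le]
    _ ≤ L * √(1 - s) * √(gap p s) := by gcongr

lemma continuousOn_boundaryTerm (hp : 0 ≤ p) (hk : ∀ s, HasDerivAt k (k' s) s)
    (hL : ∀ s, |k' s| ≤ L) : ContinuousOn (boundaryTerm p k) (Icc 0 1) := by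
  intro s hs
  rcases hs.2.eq_or_lt with rfl | hs1
  · rw [ContinuousWithinAt, boundaryTerm_one]
    have hlim : Tendsto (fun s : ℝ => L * √(1 - s)) (𝓝[Icc 0 1] 1) (𝓝 (L * √(1 - 1))) :=
      (Continuous.tendsto (by fun_prop) 1).mono_left nhdsWithin_le_nhds
    rw [sub_self, Real.sqrt_zero, mul_zero] at hlim
    refine squeeze_zero_norm' ?_ hlim
    filter_upwards [self_mem_nhdsWithin] with t ht using abs_boundaryTerm_le hp hk hL ht
  · have := (hk s).continuousAt
    exact ContinuousAt.continuousWithinAt <| ContinuousAt.div (by fun_prop)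
      (continuous_gap hp).sqrt.continuousAt (Real.sqrt_pos.2 (gap_pos hp ⟨hs.1, hs1⟩)).ne'

lemma hasDerivAt_gap {s : ℝ} (hs : s ≠ 0) : HasDerivAt (gap p) (-((p + 1) * s ^ p)) s := by
  have := (Real.hasDerivAt_rpow_const (x := s) (p := p + 1) (.inl hs)).const_sub 1
  rwa [add_sub_cancel_right] at this

lemma hasDerivAt_boundaryTerm (hp : 0 ≤ p) {s c : ℝ} (hs : s ∈ Ioo (0 : ℝ) 1)
    (hk : HasDerivAt k c s) :
    HasDerivAt (boundaryTerm p k) ((p + 1) / 2 * ((k 1 - k s) / (gap p s ^ 1 * √(gap p s))) -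
      ((p - 1) / 2 * ((k 1 - k s) / (gap p s ^ 0 * √(gap p s))) +
        s * c / (gap p s ^ 0 * √(gap p s)))) s := by
  have hgap := gap_pos_of_mem_Ioo hp hs
  have hsqrt := sqrt_gap_pos hp hs
  have hsq : √(gap p s) ^ 2 = gap p s := Real.sq_sqrt hgap.le
  refine (((hk.const_sub (k 1)).mul (hasDerivAt_id s)).div
    ((hasDerivAt_gap hs.1.ne').sqrt hgap.ne') hsqrt.ne').congr_deriv ?_
  have hpow : s ^ p * s = 1 - gap p s := by
    rw [gap, rpow_add hs.1, rpow_one]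
    ring
  simp only [id, pow_zero, one_mul, pow_one, Pi.mul_apply, hsq]
  field_simp
  rw [hsq]
  linear_combination (k 1 - k s) * (p + 1) * hpow

lemma gapInt_one_sub_eq (hp : 0 ≤ p) (hk : ∀ s, HasDerivAt k (k' s) s) (hL : ∀ s, |k' s| ≤ L)
    (hm : Measurable k') :
    gapInt p 1 (fun s => k 1 - k s) =
      2 / (p + 1) * ((p - 1) / 2 * gapInt p 0 (fun s => k 1 - k s) +
        gapInt p 0 fun s => s * k' s) := by
  have hb : GapBounded p 1 fun s => k 1 - k s := gapBounded_one_sub hp hk hL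
  have hb' : GapBounded p 0 fun s => s * k' s :=
    gapBounded_zero_of_abs_le (C := L) (by fun_prop) fun s hs => by
      rw [abs_mul, abs_of_pos hs.1]
      exact (mul_le_of_le_one_left (abs_nonneg _) hs.2.le).trans (hL s)
  have hint₁ := (hb.intervalIntegrable hp).const_mul ((p + 1) / 2)
  have hint₀ := ((hb.mono hp zero_le_one).intervalIntegrable hp).const_mul ((p - 1) / 2)
  have hint' := hb'.intervalIntegrable hp
  have hftc := integral_eq_sub_of_hasDerivAt_of_le zero_le_one (continuousOn_boundaryTerm hp hk hL)
    (fun s hs => hasDerivAt_boundaryTerm hp hs (hk s)) (hint₁.sub (hint₀.add hint'))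
  rw [intervalIntegral.integral_sub hint₁ (hint₀.add hint'),
    intervalIntegral.integral_add hint₀ hint', intervalIntegral.integral_const_mul,
    intervalIntegral.integral_const_mul, boundaryTerm_one, boundaryTerm, mul_zero, zero_div,
    sub_zero] at hftc
  change (p + 1) / 2 * gapInt p 1 (fun s => k 1 - k s) -
    ((p - 1) / 2 * gapInt p 0 (fun s => k 1 - k s) + gapInt p 0 fun s => s * k' s) = 0 at hftc
  rw [← sub_eq_zero.1 hftc, ← mul_assoc, div_mul_div_cancel₀ (by positivity),
    div_self two_ne_zero, one_mul]

end integrationByParts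

section trigonometric

variable {p : ℝ}

lemma hasDerivAt_sin_mul (c s : ℝ) : HasDerivAt (fun s => sin (c * s)) (c * cos (c * s)) s := by
  simpa only [id, mul_one, mul_comm] using ((hasDerivAt_id s).const_mul c).sin

lemma hasDerivAt_cos_mul (c s : ℝ) :
    HasDerivAt (fun s => cos (c * s)) (-c * sin (c * s)) s := by
  simpa only [id, mul_one, mul_comm, neg_mul, mul_neg] using ((hasDerivAt_id s).const_mul c).cos

lemma abs_mul_cos_le (c x : ℝ) : |c * cos x| ≤ |c| := by
  rw [abs_mul]
  exact mul_le_of_le_one_right (abs_nonneg _) (abs_cos_le_one _)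

lemma abs_mul_sin_le (c x : ℝ) : |c * sin x| ≤ |c| := by
  rw [abs_mul]
  exact mul_le_of_le_one_right (abs_nonneg _) (abs_sin_le_one _)

lemma gapBounded_sin_sub_sin_mul (hp : 0 ≤ p) (c : ℝ) :
    GapBounded p 1 fun s => sin c - sin (c * s) := by
  simpa only [mul_one] using
    gapBounded_one_sub hp (hasDerivAt_sin_mul c) fun s => abs_mul_cos_le c (c * s)

lemma gapBounded_cos_sub_cos_mul (hp : 0 ≤ p) (c : ℝ) :
    GapBounded p 1 fun s => cos c - cos (c * s) := by
  simpa only [mul_one] using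
    gapBounded_one_sub hp (hasDerivAt_cos_mul c) fun s => abs_mul_sin_le (-c) (c * s)

lemma gapBounded_one_sub_mul_sin (hp : 0 ≤ p) (c : ℝ) :
    GapBounded p 1 fun s => (1 - s) * sin (c * s) :=
  gapBounded_one_of_abs_le (C := 1) hp zero_le_one (by fun_prop) fun s hs => by
    rw [one_mul]
    exact (abs_mul_sin_le _ _).trans_eq (abs_of_pos (sub_pos.2 hs.2))

lemma gapBounded_sin_sub_mul_sin (c : ℝ) : GapBounded p 0 fun s => sin c - s * sin (c * s) :=
  gapBounded_zero_of_abs_le (C := 1 + 1) (by fun_prop) fun s hs =>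
    (abs_sub _ _).trans <| add_le_add (abs_sin_le_one _) <|
      (abs_mul_sin_le _ _).trans ((abs_of_pos hs.1).trans_le hs.2.le)

lemma gapInt_one_sin_sub_sin_mul (hp : 0 ≤ p) (c : ℝ) :
    gapInt p 1 (fun s => sin c - sin (c * s)) =
      2 / (p + 1) * ((p - 1) / 2 * gapInt p 0 (fun s => sin c - sin (c * s)) +
        c * gapInt p 0 fun s => s * cos (c * s)) := by
  rw [← gapInt_const_mul c]
  simpa only [mul_one, mul_left_comm _ c] using
    gapInt_one_sub_eq hp (hasDerivAt_sin_mul c) (fun s => abs_mul_cos_le c (c * s)) (by fun_prop)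

lemma gapInt_one_cos_sub_cos_mul (hp : 0 ≤ p) (c : ℝ) :
    gapInt p 1 (fun s => cos c - cos (c * s)) =
      2 / (p + 1) * ((p - 1) / 2 * gapInt p 0 (fun s => cos c - cos (c * s)) +
        -c * gapInt p 0 fun s => s * sin (c * s)) := by
  rw [← gapInt_const_mul (-c)]
  simpa only [mul_one, mul_left_comm _ (-c)] using
    gapInt_one_sub_eq hp (hasDerivAt_cos_mul c) (fun s => abs_mul_sin_le (-c) (c * s))
      (by fun_prop)

end trigonometric

section perturbation

variable {p α : ℝ}

lemma gapInt_pert {n : ℕ} (hp : 0 ≤ p) (hα : 0 < α) (hsq : GapBounded p n fun s => 1 - s ^ 2)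
    (hripple : GapBounded p n (ripple α)) :
    gapInt p n (pert p α) = (p + 1) / 4 * α ^ (1 - p) *
      ((gapInt p n fun s => 1 - s ^ 2) - gapInt p n (ripple α)) := by
  rw [← gapInt_sub hp hsq hripple, ← gapInt_const_mul]
  exact gapInt_congr fun s _ => pert_eq hα s

lemma gapInt_pert_sq (n : ℕ) (hα : 0 < α) :
    (gapInt p n fun s => pert p α s ^ 2) = (p + 1) ^ 2 / 16 * (α ^ (1 - p)) ^ 2 *
      gapInt p n fun s => ((1 - s ^ 2) - ripple α s) ^ 2 := by
  rw [← gapInt_const_mul]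
  refine gapInt_congr fun s _ => ?_
  rw [pert_eq hα]
  ring

lemma gapInt_one_ripple (hp : 0 ≤ p) (α : ℝ) :
    gapInt p 1 (ripple α) =
      1 / α * ((gapInt p 1 fun s => sin (2 * α) - sin (2 * α * s)) +
        gapInt p 1 fun s => (1 - s) * sin (2 * α * s)) +
      1 / (2 * α ^ 2) * gapInt p 1 fun s => cos (2 * α) - cos (2 * α * s) := by
  have hsin := gapBounded_sin_sub_sin_mul hp (2 * α)
  have hcos := gapBounded_cos_sub_cos_mul hp (2 * α)
  have hmul := gapBounded_one_sub_mul_sin hp (2 * α)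
  rw [← gapInt_add hp hsin hmul, ← gapInt_const_mul, ← gapInt_const_mul,
    ← gapInt_add hp ((hsin.add hmul).const_mul _) (hcos.const_mul _)]
  refine gapInt_congr fun s _ => ?_
  rw [ripple]
  ring

lemma gapInt_zero_ripple (hp : 0 ≤ p) (α : ℝ) :
    gapInt p 0 (ripple α) =
      1 / α * (gapInt p 0 fun s => sin (2 * α) - s * sin (2 * α * s)) +
      1 / (2 * α ^ 2) * gapInt p 0 fun s => cos (2 * α) - cos (2 * α * s) := by
  rw [← gapInt_const_mul, ← gapInt_const_mul,
    ← gapInt_add hp ((gapBounded_sin_sub_mul_sin _).const_mul _)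
      (((gapBounded_cos_sub_cos_mul hp _).mono hp zero_le_one).const_mul _)]
  refine gapInt_congr fun s _ => ?_
  rw [ripple]
  ring

lemma gapInt_one_pert (hp : 1 ≤ p) (hα : 0 < α) :
    -(1 / 2) * gapInt p 1 (pert p α) = α ^ (1 - p) *
      (C1 p + 1 / 2 * C11 p α + 1 / 2 * (C12 p α + C21 p α) / α + 1 / 2 * C22 p α / α ^ 2) := by
  have hp0 : 0 ≤ p := by linarith
  have hp1 : -1 < p := by linarith
  rw [gapInt_pert hp0 hα (gapBounded_one_sub_sq hp0) (gapBounded_ripple hp hα),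
    gapInt_one_ripple hp0, gapInt_one_sin_sub_sin_mul hp0, gapInt_one_cos_sub_cos_mul hp0,
    C1_eq hp0, C11_eq hp1, C12_eq hp0, C21_eq hp1, C22_eq hp1]
  generalize (gapInt p 1 fun s => 1 - s ^ 2) = quad
  generalize (gapInt p 0 fun s => sin (2 * α) - sin (2 * α * s)) = sinDiff
  generalize (gapInt p 0 fun s => cos (2 * α) - cos (2 * α * s)) = cosDiff
  generalize (gapInt p 1 fun s => (1 - s) * sin (2 * α * s)) = oneSubSin
  generalize (gapInt p 0 fun s => s * cos (2 * α * s)) = mulCos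
  generalize (gapInt p 0 fun s => s * sin (2 * α * s)) = mulSin
  field_simp
  ring

lemma gapInt_zero_pert (hp : 1 ≤ p) (hα : 0 < α) :
    1 / 2 * gapInt p 0 (pert p α) = α ^ (1 - p) * (E1 p + E2 p α / α + E3 p α / α ^ 2) := by
  have hp0 : 0 ≤ p := by linarith
  have hp1 : -1 < p := by linarith
  rw [gapInt_pert hp0 hα ((gapBounded_one_sub_sq hp0).mono hp0 zero_le_one)
    ((gapBounded_ripple hp hα).mono hp0 zero_le_one), gapInt_zero_ripple hp0, E1_eq, E2_eq hp1,
    E3_eq hp1]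
  generalize (gapInt p 0 fun s => 1 - s ^ 2) = quad
  generalize (gapInt p 0 fun s => sin (2 * α) - s * sin (2 * α * s)) = sinDiff
  generalize (gapInt p 0 fun s => cos (2 * α) - cos (2 * α * s)) = cosDiff
  field_simp
  ring

end perturbation

section squareRootExpansion

lemma exists_eq_sq_of_pos_of_nonneg {g d : ℝ} (hg : 0 < g) (hd : 0 ≤ d) :
    ∃ z y : ℝ, 0 < z ∧ z ≤ y ∧ g = z ^ 2 ∧ d = y ^ 2 - z ^ 2 :=
  ⟨√g, √(g + d), Real.sqrt_pos.2 hg, Real.sqrt_le_sqrt (le_add_of_nonneg_right hd),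
    (Real.sq_sqrt hg.le).symm, by
      rw [Real.sq_sqrt hg.le, Real.sq_sqrt (by positivity), add_sub_cancel_left]⟩

lemma abs_one_div_sqrt_add_sub_le {g d : ℝ} (hg : 0 < g) (hd : 0 ≤ d) :
    |1 / √(g + d) - (1 / √g - 1 / 2 * (d / (g ^ 1 * √g)) + 3 / 8 * (d ^ 2 / (g ^ 2 * √g)))| ≤
      |d ^ 3 / (g ^ 3 * √g)| := by
  obtain ⟨z, y, hz, hzy, rfl, rfl⟩ := exists_eq_sq_of_pos_of_nonneg hg hd
  have hy : 0 < y := hz.trans_le hzy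
  have hremainder : 1 / y - (1 / z - 1 / 2 * ((y ^ 2 - z ^ 2) / ((z ^ 2) ^ 1 * z)) +
      3 / 8 * ((y ^ 2 - z ^ 2) ^ 2 / ((z ^ 2) ^ 2 * z))) =
      -((y - z) ^ 3 * (3 * y ^ 2 + 9 * y * z + 8 * z ^ 2) / (8 * y * z ^ 5)) := by
    field_simp
    ring
  have hfactor : (3 * y ^ 2 + 9 * y * z + 8 * z ^ 2) * z ^ 2 ≤ (y + z) ^ 3 * (8 * y) :=
    calc (3 * y ^ 2 + 9 * y * z + 8 * z ^ 2) * z ^ 2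
        ≤ (3 * y ^ 2 + 9 * y * y + 8 * y ^ 2) * z ^ 2 := by gcongr
      _ ≤ (3 * y ^ 2 + 9 * y * y + 8 * y ^ 2) * z ^ 2 +
          (8 * y ^ 4 + 24 * y ^ 3 * z + 4 * y ^ 2 * z ^ 2 + 8 * y * z ^ 3) :=
        le_add_of_nonneg_right (by positivity)
      _ = (y + z) ^ 3 * (8 * y) := by ring
  have : 0 ≤ (y - z) ^ 3 := pow_nonneg (sub_nonneg.2 hzy) 3
  rw [add_sub_cancel, Real.sqrt_sq hy.le, Real.sqrt_sq hz.le, hremainder, abs_neg,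
    abs_of_nonneg (by positivity), abs_of_nonneg (by positivity),
    div_le_div_iff₀ (by positivity) (by positivity)]
  calc (y - z) ^ 3 * (3 * y ^ 2 + 9 * y * z + 8 * z ^ 2) * ((z ^ 2) ^ 3 * z)
      = (y - z) ^ 3 * ((3 * y ^ 2 + 9 * y * z + 8 * z ^ 2) * z ^ 2) * z ^ 5 := by ring
    _ ≤ (y - z) ^ 3 * ((y + z) ^ 3 * (8 * y)) * z ^ 5 := by gcongr
    _ = (y ^ 2 - z ^ 2) ^ 3 * (8 * y * z ^ 5) := by ring

lemma abs_sqrt_add_sub_le {g d : ℝ} (hg : 0 < g) (hd : 0 ≤ d) :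
    |√(g + d) - (√g + 1 / 2 * (d / (g ^ 0 * √g)) - 1 / 8 * (d ^ 2 / (g ^ 1 * √g)))| ≤
      |d ^ 3 / (g ^ 2 * √g)| := by
  obtain ⟨z, y, hz, hzy, rfl, rfl⟩ := exists_eq_sq_of_pos_of_nonneg hg hd
  have hy : 0 < y := hz.trans_le hzy
  have hremainder : y - (z + 1 / 2 * ((y ^ 2 - z ^ 2) / ((z ^ 2) ^ 0 * z)) -
      1 / 8 * ((y ^ 2 - z ^ 2) ^ 2 / ((z ^ 2) ^ 1 * z))) =
      (y - z) ^ 3 * (y + 3 * z) / (8 * z ^ 3) := by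
    field_simp
    ring
  have hfactor : (y + 3 * z) * z ^ 2 ≤ (y + z) ^ 3 * 8 :=
    calc (y + 3 * z) * z ^ 2
        ≤ (y + 3 * z) * z ^ 2 + (8 * y ^ 3 + 24 * y ^ 2 * z + 23 * y * z ^ 2 + 5 * z ^ 3) :=
        le_add_of_nonneg_right (by positivity)
      _ = (y + z) ^ 3 * 8 := by ring
  have : 0 ≤ (y - z) ^ 3 := pow_nonneg (sub_nonneg.2 hzy) 3
  rw [add_sub_cancel, Real.sqrt_sq hy.le, Real.sqrt_sq hz.le, hremainder,
    abs_of_nonneg (by positivity), abs_of_nonneg (by positivity),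
    div_le_div_iff₀ (by positivity) (by positivity)]
  calc (y - z) ^ 3 * (y + 3 * z) * ((z ^ 2) ^ 2 * z)
      = (y - z) ^ 3 * ((y + 3 * z) * z ^ 2) * z ^ 3 := by ring
    _ ≤ (y - z) ^ 3 * ((y + z) ^ 3 * 8) * z ^ 3 := by gcongr
    _ = (y ^ 2 - z ^ 2) ^ 3 * (8 * z ^ 3) := by ring

variable {p ε : ℝ} {d : ℝ → ℝ}

lemma gapBounded_of_nonneg_of_le (hm : Measurable d) (hd : ∀ s ∈ Ioo (0 : ℝ) 1, 0 ≤ d s)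
    (hle : ∀ s ∈ Ioo (0 : ℝ) 1, d s ≤ ε * gap p s) : GapBounded p 1 d :=
  ⟨hm, ε, fun s hs => by
    rw [abs_of_nonneg (hd s hs), pow_one]
    exact hle s hs⟩

lemma abs_pow_three_le {x y : ℝ} (hx : 0 ≤ x) (hle : x ≤ ε * y) : |x ^ 3| ≤ ε ^ 3 * y ^ 3 := by
  rw [abs_of_nonneg (pow_nonneg hx 3), ← mul_pow]
  exact pow_le_pow_left₀ hx hle 3

lemma abs_integral_one_div_sqrt_gap_add_sub_le (hp : 0 ≤ p) (hm : Measurable d)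
    (hd : ∀ s ∈ Ioo (0 : ℝ) 1, 0 ≤ d s) (hle : ∀ s ∈ Ioo (0 : ℝ) 1, d s ≤ ε * gap p s) :
    |(∫ s in (0 : ℝ)..1, 1 / √(gap p s + d s)) -
      (C0 p - 1 / 2 * gapInt p 1 d + 3 / 8 * gapInt p 2 fun s => d s ^ 2)| ≤ ε ^ 3 * C0 p := by
  have hb := gapBounded_of_nonneg_of_le hm hd hle
  have hgm := measurable_gap p
  have hint₀ := intervalIntegrable_one_div_sqrt_gap hp
  have hint₁ := (hb.intervalIntegrable hp).const_mul (1 / 2)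
  have hint₂ := (hb.sq.intervalIntegrable hp).const_mul (3 / 8)
  have hint : IntervalIntegrable (fun s => 1 / √(gap p s + d s)) volume 0 1 := by
    refine intervalIntegrable_of_abs_le_div_sqrt_gap (C := 1) hp (by fun_prop) fun s hs => ?_
    have := sqrt_gap_pos hp hs
    rw [abs_of_nonneg (by positivity), one_mul]
    gcongr
    exact le_add_of_nonneg_right (hd s hs)
  have hsplit : (∫ s in (0 : ℝ)..1, 1 / √(gap p s + d s)) -
      (C0 p - 1 / 2 * gapInt p 1 d + 3 / 8 * gapInt p 2 fun s => d s ^ 2) =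
      ∫ s in (0 : ℝ)..1, (1 / √(gap p s + d s) - (1 / √(gap p s) -
        1 / 2 * (d s / (gap p s ^ 1 * √(gap p s))) +
        3 / 8 * (d s ^ 2 / (gap p s ^ 2 * √(gap p s))))) := by
    rw [intervalIntegral.integral_sub hint ((hint₀.sub hint₁).add hint₂),
      intervalIntegral.integral_add (hint₀.sub hint₁) hint₂,
      intervalIntegral.integral_sub hint₀ hint₁, intervalIntegral.integral_const_mul,
      intervalIntegral.integral_const_mul]
    rfl
  rw [hsplit]
  refine abs_integral_le_mul_C0 hp fun s hs => ?_
  exact (abs_one_div_sqrt_add_sub_le (gap_pos_of_mem_Ioo hp hs) (hd s hs)).trans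
    (abs_div_gap_le hp hs (abs_pow_three_le (hd s hs) (hle s hs)))

lemma sqrt_gap_add_le (hp : 0 ≤ p) {s x : ℝ} (hs : s ∈ Ioo (0 : ℝ) 1) (hx : 0 ≤ x)
    (hle : x ≤ ε * gap p s) : √(gap p s + x) ≤ (1 + ε) * (1 / √(gap p s)) := by
  have hgap := gap_pos_of_mem_Ioo hp hs
  have hε : 0 ≤ ε := nonneg_of_mul_nonneg_left (hx.trans hle) hgap
  rw [mul_one_div, le_div_iff₀ (sqrt_gap_pos hp hs)]
  calc √(gap p s + x) * √(gap p s) ≤ √(gap p s + x) * √(gap p s + x) := by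
        gcongr
        exact le_add_of_nonneg_right hx
    _ = gap p s + x := Real.mul_self_sqrt (by positivity)
    _ ≤ (1 + ε) * gap p s := by linarith
    _ ≤ 1 + ε := mul_le_of_le_one_right (by positivity) (gap_le_one hs.1.le)

lemma abs_integral_sqrt_gap_add_sub_le (hp : 0 ≤ p) (hm : Measurable d)
    (hd : ∀ s ∈ Ioo (0 : ℝ) 1, 0 ≤ d s) (hle : ∀ s ∈ Ioo (0 : ℝ) 1, d s ≤ ε * gap p s) :
    |(∫ s in (0 : ℝ)..1, √(gap p s + d s)) -
      (E0 p + 1 / 2 * gapInt p 0 d - 1 / 8 * gapInt p 1 fun s => d s ^ 2)| ≤ ε ^ 3 * C0 p := by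
  have hb := gapBounded_of_nonneg_of_le hm hd hle
  have hgm := measurable_gap p
  have hint₀ : IntervalIntegrable (fun s => √(gap p s)) volume 0 1 :=
    (continuous_gap hp).sqrt.intervalIntegrable _ _
  have hint₁ := ((hb.mono hp zero_le_one).intervalIntegrable hp).const_mul (1 / 2)
  have hint₂ := ((hb.sq.mono hp one_le_two).intervalIntegrable hp).const_mul (1 / 8)
  have hint : IntervalIntegrable (fun s => √(gap p s + d s)) volume 0 1 :=
    intervalIntegrable_of_abs_le_div_sqrt_gap hp (by fun_prop) fun s hs =>
      (abs_of_nonneg (Real.sqrt_nonneg _)).trans_le (sqrt_gap_add_le hp hs (hd s hs) (hle s hs))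
  have hsplit : (∫ s in (0 : ℝ)..1, √(gap p s + d s)) -
      (E0 p + 1 / 2 * gapInt p 0 d - 1 / 8 * gapInt p 1 fun s => d s ^ 2) =
      ∫ s in (0 : ℝ)..1, (√(gap p s + d s) - (√(gap p s) +
        1 / 2 * (d s / (gap p s ^ 0 * √(gap p s))) -
        1 / 8 * (d s ^ 2 / (gap p s ^ 1 * √(gap p s))))) := by
    rw [intervalIntegral.integral_sub hint ((hint₀.add hint₁).sub hint₂),
      intervalIntegral.integral_sub (hint₀.add hint₁) hint₂,
      intervalIntegral.integral_add hint₀ hint₁, intervalIntegral.integral_const_mul,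
      intervalIntegral.integral_const_mul]
    rfl
  rw [hsplit]
  refine abs_integral_le_mul_C0 hp fun s hs => ?_
  have hgap := gap_pos_of_mem_Ioo hp hs
  have hε : 0 ≤ ε := nonneg_of_mul_nonneg_left ((hd s hs).trans (hle s hs)) hgap
  have hcube : |d s ^ 3| ≤ ε ^ 3 * gap p s ^ 2 :=
    (abs_pow_three_le (hd s hs) (hle s hs)).trans (mul_le_mul_of_nonneg_left
      (pow_le_pow_of_le_one hgap.le (gap_le_one hs.1.le) (by norm_num)) (by positivity))
  exact (abs_sqrt_add_sub_le hgap (hd s hs)).trans (abs_div_gap_le hp hs hcube)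

end squareRootExpansion

section gapIntLimits

variable {p : ℝ} {n : ℕ}

lemma tendsto_ripple {s : ℝ} (hs : s ∈ Ioo (0 : ℝ) 1) :
    Tendsto (fun α => ripple α s) atTop (𝓝 0) := by
  have hsin (α : ℝ) : |sin (2 * α) - s * sin (2 * α * s)| ≤ 1 + 1 :=
    (abs_sub _ _).trans <| add_le_add (abs_sin_le_one _) <|
      (abs_mul_sin_le _ _).trans ((abs_of_pos hs.1).trans_le hs.2.le)
  have hcos (α : ℝ) : |cos (2 * α) - cos (2 * α * s)| ≤ 1 + 1 :=
    (abs_sub _ _).trans (add_le_add (abs_cos_le_one _) (abs_cos_le_one _))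
  have hsq : Tendsto (fun α : ℝ => 2 * α ^ 2) atTop atTop :=
    (tendsto_pow_atTop two_ne_zero).const_mul_atTop two_pos
  have hfirst := bdd_le_mul_tendsto_zero' (1 + 1) (.of_forall hsin) tendsto_inv_atTop_zero
  have hsecond := bdd_le_mul_tendsto_zero' (1 + 1) (.of_forall hcos)
    (tendsto_inv_atTop_zero.comp hsq)
  rw [← add_zero (0 : ℝ)]
  exact hfirst.add hsecond

lemma tendsto_gapInt {C : ℝ} {φ : ℝ → ℝ → ℝ} {ψ : ℝ → ℝ} (hp : 0 ≤ p)
    (hm : ∀ α, Measurable (φ α))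
    (hb : ∀ᶠ α in atTop, ∀ s ∈ Ioo (0 : ℝ) 1, |φ α s| ≤ C * gap p s ^ n)
    (hl : ∀ s ∈ Ioo (0 : ℝ) 1, Tendsto (fun α => φ α s) atTop (𝓝 (ψ s))) :
    Tendsto (fun α => gapInt p n (φ α)) atTop (𝓝 (gapInt p n ψ)) := by
  have hint := (intervalIntegrable_one_div_sqrt_gap hp).const_mul C
  rw [intervalIntegrable_iff_integrableOn_Ioo_of_le zero_le_one] at hint
  simp only [gapInt, integral_of_le zero_le_one, integral_Ioc_eq_integral_Ioo]
  refine tendsto_integral_filter_of_dominated_convergence _ (.of_forall fun α => ?_) ?_ hint ?_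
  · have := measurable_gap p
    have := hm α
    exact Measurable.aestronglyMeasurable (by fun_prop)
  · filter_upwards [hb] with α hα
    exact ae_restrict_of_forall_mem measurableSet_Ioo fun s hs => abs_div_gap_le hp hs (hα s hs)
  · exact ae_restrict_of_forall_mem measurableSet_Ioo fun s hs => (hl s hs).div_const _

lemma tendsto_gapInt_sq (hp : 1 ≤ p) (hn : n ≤ 2) :
    Tendsto (fun α => gapInt p n fun s => ((1 - s ^ 2) - ripple α s) ^ 2) atTop
      (𝓝 (gapInt p n fun s => (1 - s ^ 2) ^ 2)) := by
  have hp0 : 0 ≤ p := by linarith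
  refine tendsto_gapInt (C := 4) hp0 (fun α => ?_) ?_ fun s hs => ?_
  · have := measurable_ripple α
    fun_prop
  · filter_upwards [eventually_gt_atTop 0] with α hα s hs
    have hripple := abs_le.1 (abs_ripple_le hα (Ioo_subset_Icc_self hs))
    have hle := one_sub_sq_le_gap hp (Ioo_subset_Icc_self hs)
    rw [abs_of_nonneg (sq_nonneg _)]
    calc ((1 - s ^ 2) - ripple α s) ^ 2 ≤ (2 * gap p s) ^ 2 :=
          pow_le_pow_left₀ (by linarith) (by linarith) 2
      _ = 4 * gap p s ^ 2 := by ring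
      _ ≤ 4 * gap p s ^ n := mul_le_mul_of_nonneg_left
          (pow_le_pow_of_le_one (gap_pos_of_mem_Ioo hp0 hs).le (gap_le_one hs.1.le) hn) (by simp)
  · simpa only [sub_zero] using ((tendsto_ripple hs).const_sub (1 - s ^ 2)).pow 2

end gapIntLimits

section riemannLebesgue

variable {f : ℝ → ℝ}

lemma integral_mul_cos_eq_re (hf : Integrable f) (c : ℝ) :
    ∫ v, f v * cos (c * v) =
      (∫ v, Real.fourierChar (-(v * (c / (2 * π)))) • (f v : ℂ)).re := by
  have hint : Integrable fun v => Real.fourierChar (-(v * (c / (2 * π)))) • (f v : ℂ) := by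
    have hcont : Continuous fun v : ℝ => Real.fourierChar (-(v * (c / (2 * π)))) :=
      Real.continuous_fourierChar.comp (by fun_prop)
    exact hf.ofReal.mono (hcont.aestronglyMeasurable.smul hf.ofReal.aestronglyMeasurable)
      (.of_forall fun v => (Circle.norm_smul _ _).le)
  have hfreq (v : ℝ) : 2 * π * -(v * (c / (2 * π))) = -(c * v) := by
    field_simp
  rw [← Complex.reCLM_apply, ← Complex.reCLM.integral_comp_comm hint]
  refine integral_congr_ae (.of_forall fun v => ?_)
  beta_reduce
  rw [Complex.reCLM_apply, Circle.smul_def, Real.fourierChar_apply, smul_eq_mul,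
    Complex.re_mul_ofReal, Complex.exp_ofReal_mul_I_re, hfreq, cos_neg, mul_comm]

lemma tendsto_integral_mul_cos (hf : Integrable f) :
    Tendsto (fun c => ∫ v, f v * cos (c * v)) atTop (𝓝 0) := by
  have hfreq : Tendsto (fun c : ℝ => c / (2 * π)) atTop (cocompact ℝ) :=
    (tendsto_id.atTop_div_const two_pi_pos).mono_right atTop_le_cocompact
  simp only [integral_mul_cos_eq_re hf]
  exact (Complex.continuous_re.tendsto' 0 0 Complex.zero_re).comp
    ((Real.tendsto_integral_exp_smul_cocompact fun v => (f v : ℂ)).comp hfreq)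

lemma tendsto_intervalIntegral_mul_cos {a b : ℝ} (hf : IntervalIntegrable f volume a b) :
    Tendsto (fun c => ∫ s in a..b, f s * cos (c * s)) atTop (𝓝 0) := by
  have hlim := (tendsto_integral_mul_cos
    ((integrable_indicator_iff measurableSet_uIoc).2 hf.def')).const_smul
      (if a ≤ b then 1 else -1 : ℝ)
  rw [smul_zero] at hlim
  refine hlim.congr fun c => ?_
  simp only [intervalIntegral_eq_integral_uIoc,
    ← MeasureTheory.integral_indicator measurableSet_uIoc, indicator_mul_left]

end riemannLebesgue

section coefficientC3

lemma integral_one_sub_rpow_neg_three_halves {s : ℝ} (hs : s < 1) :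
    ∫ y in (0 : ℝ)..s, (1 - y) ^ (-(3 / 2) : ℝ) = 2 * (1 / √(1 - s)) - 2 := by
  have hpos : 0 < 1 - s := sub_pos.2 hs
  rw [integral_comp_sub_left (fun x => x ^ (-(3 / 2) : ℝ)), sub_zero,
    integral_rpow (.inr ⟨by norm_num, notMem_uIcc_of_lt hpos one_pos⟩),
    show (-(3 / 2) + 1 : ℝ) = -(1 / 2) by norm_num, one_rpow, rpow_neg hpos.le,
    ← Real.sqrt_eq_rpow]
  ring

lemma intervalIntegrable_primitive {k : ℝ → ℝ} (hk : ContinuousOn k (Ico 0 1))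
    (h0 : ∀ y ∈ Ico (0 : ℝ) 1, 0 ≤ k y)
    (hle : ∀ y ∈ Ico (0 : ℝ) 1, k y ≤ (1 - y) ^ (-(3 / 2) : ℝ)) :
    IntervalIntegrable (fun s => ∫ y in (0 : ℝ)..s, k y) volume 0 1 := by
  have hint {a b : ℝ} (ha : a ∈ Ico (0 : ℝ) 1) (hb : b ∈ Ico (0 : ℝ) 1) :
      IntervalIntegrable k volume a b :=
    (hk.mono (ordConnected_Ico.uIcc_subset ha hb)).intervalIntegrable
  have hzero : (0 : ℝ) ∈ Ico (0 : ℝ) 1 := left_mem_Ico.2 one_pos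
  have hmono : MonotoneOn (fun s => ∫ y in (0 : ℝ)..s, k y) (Ioo 0 1) := by
    intro a ha b hb hab
    have ha' := Ioo_subset_Ico_self ha
    have hb' := Ioo_subset_Ico_self hb
    rw [← sub_nonneg, integral_interval_sub_left (hint hzero hb') (hint hzero ha')]
    exact integral_nonneg hab fun y hy => h0 y ⟨ha.1.le.trans hy.1, hy.2.trans_lt hb.2⟩
  refine intervalIntegrable_of_abs_le_div_sqrt_one_sub (C := 2)
    (aemeasurable_restrict_of_monotoneOn measurableSet_Ioo hmono).aestronglyMeasurable
    fun s hs => ?_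
  have hmem {y : ℝ} (hy : y ∈ Icc 0 s) : y ∈ Ico (0 : ℝ) 1 := ⟨hy.1, hy.2.trans_lt hs.2⟩
  have hdom : IntervalIntegrable (fun y : ℝ => (1 - y) ^ (-(3 / 2) : ℝ)) volume 0 s :=
    ContinuousOn.intervalIntegrable_of_Icc hs.1.le <|
      ContinuousOn.rpow_const (by fun_prop) fun y hy => .inl (sub_pos.2 (hmem hy).2).ne'
  rw [abs_of_nonneg (integral_nonneg hs.1.le fun y hy => h0 y (hmem hy))]
  calc ∫ y in (0 : ℝ)..s, k y ≤ ∫ y in (0 : ℝ)..s, (1 - y) ^ (-(3 / 2) : ℝ) :=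
        integral_mono_on hs.1.le (hint hzero (Ioo_subset_Ico_self hs)) hdom
          fun y hy => hle y (hmem hy)
    _ = 2 * (1 / √(1 - s)) - 2 := integral_one_sub_rpow_neg_three_halves hs.2
    _ ≤ 2 * (1 / √(1 - s)) := sub_le_self _ zero_le_two

lemma tendsto_C3 {p : ℝ} (hp : 1 ≤ p) : Tendsto (C3 p) atTop (𝓝 0) := by
  have hp0 : 0 ≤ p := by linarith
  have hcont : ContinuousOn (fun y => (1 - y ^ 2) / gap p y ^ (5 / 2 : ℝ)) (Ico 0 1) :=
    ContinuousOn.div (by fun_prop)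
      ((continuous_gap hp0).continuousOn.rpow_const fun y hy => .inl (gap_pos hp0 hy).ne')
      fun y hy => (rpow_pos_of_pos (gap_pos hp0 hy) _).ne'
  have hint := intervalIntegrable_primitive hcont
    (fun y hy => div_nonneg (sub_nonneg.2 (pow_le_one₀ hy.1 hy.2.le))
      (rpow_nonneg (gap_pos hp0 hy).le _))
    fun y hy => by
      have hgap := gap_pos hp0 hy
      calc (1 - y ^ 2) / gap p y ^ (5 / 2 : ℝ) ≤ gap p y / gap p y ^ (5 / 2 : ℝ) := by
            gcongr
            exact one_sub_sq_le_gap hp (Ico_subset_Icc_self hy)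
        _ = gap p y ^ (-(3 / 2) : ℝ) := by
            rw [show (-(3 / 2) : ℝ) = 1 - 5 / 2 by norm_num, rpow_sub hgap, rpow_one]
        _ ≤ (1 - y) ^ (-(3 / 2) : ℝ) := rpow_le_rpow_of_nonpos (sub_pos.2 hy.2)
            (one_sub_le_gap hp0 (Ico_subset_Icc_self hy)) (by norm_num)
  have hlim := ((tendsto_intervalIntegral_mul_cos hint).comp
    (tendsto_id.const_mul_atTop two_pos)).const_mul (-(3 / 32) * (p + 1) ^ 2)
  rw [mul_zero] at hlim
  exact hlim

end coefficientC3

section cosineIntegrals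

variable {h : ℝ → ℝ} {a : ℝ}

lemma intervalIntegral_pos_of_pos_on_diff {f : ℝ → ℝ} {a b : ℝ} {S : Set ℝ}
    (hf : IntervalIntegrable f volume a b) (hS : S.Countable)
    (hpos : ∀ s ∈ Ioo a b \ S, 0 < f s) (hab : a < b) : 0 < ∫ s in a..b, f s := by
  classical
  have hae : ∀ᵐ s, s ∈ uIoc a b → f s = S.piecewise 1 f s := by
    filter_upwards [hS.ae_notMem volume] with s hs _
    rw [piecewise_eq_of_notMem _ _ _ hs]
  rw [intervalIntegral.integral_congr_ae hae]
  refine intervalIntegral_pos_of_pos_on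
    (hf.congr_ae ((ae_restrict_iff' measurableSet_uIoc).2 hae)) (fun s hs => ?_) hab
  by_cases hsS : s ∈ S
  · rw [piecewise_eq_of_mem _ _ _ hsS]
    exact one_pos
  · rw [piecewise_eq_of_notMem _ _ _ hsS]
    exact hpos s ⟨hs, hsS⟩

lemma cos_mul_sub_mul_sub_pos {x : ℝ} (hx : x ∈ Ioo 0 (2 * π)) (h₁ : x ≠ π / 2)
    (h₂ : x ≠ 3 * π / 2) : 0 < cos x * ((x - π / 2) * (x - 3 * π / 2)) := by
  have := pi_pos
  rcases h₁.lt_or_gt with h₁ | h₁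
  · exact mul_pos (cos_pos_of_mem_Ioo ⟨by linarith [hx.1], h₁⟩)
      (mul_pos_of_neg_of_neg (by linarith) (by linarith))
  rcases h₂.lt_or_gt with h₂ | h₂
  · exact mul_pos_of_neg_of_neg (cos_neg_of_pi_div_two_lt_of_lt h₁ (by linarith))
      (mul_neg_of_pos_of_neg (by linarith) (by linarith))
  · rw [← cos_sub_two_pi]
    exact mul_pos (cos_pos_of_mem_Ioo ⟨by linarith, by linarith [hx.2]⟩)
      (mul_pos (by linarith) (by linarith))

lemma sub_secant_mul_sub_mul_sub_pos {S : Set ℝ} {x y s : ℝ} (hh : StrictConvexOn ℝ S h)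
    (hx : x ∈ S) (hy : y ∈ S) (hs : s ∈ S) (hxy : x ≠ y) (hsx : s ≠ x) (hsy : s ≠ y) :
    0 < (h s - (h x + (h y - h x) / (y - x) * (s - x))) * ((s - x) * (s - y)) := by
  have hslope : 0 < ((h s - h x) / (s - x) - (h y - h x) / (y - x)) * (s - y) := by
    rcases hsy.lt_or_gt with hlt | hgt
    · exact mul_pos_of_neg_of_neg
        (sub_neg.2 (hh.secant_strict_mono hx hs hy hsx hxy.symm hlt)) (sub_neg.2 hlt)
    · exact mul_pos
        (sub_pos.2 (hh.secant_strict_mono hx hy hs hxy.symm hsx hgt)) (sub_pos.2 hgt)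
  have hsx := sub_ne_zero.2 hsx
  calc 0 < (s - x) ^ 2 * (((h s - h x) / (s - x) - (h y - h x) / (y - x)) * (s - y)) := by
        positivity
    _ = _ := by
      linear_combination (s - x) * (s - y) * div_mul_cancel₀ (h s - h x) hsx

lemma integral_affine_mul_cos_period (c m a : ℝ) :
    ∫ s in a..a + 2 * π, (c + m * (s - a)) * cos (s - a) = 0 := by
  have hderiv (s : ℝ) : HasDerivAt (fun s => (c + m * (s - a)) * sin (s - a) + m * cos (s - a))
      ((c + m * (s - a)) * cos (s - a)) s := by
    have hsub := (hasDerivAt_id s).sub_const a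
    refine ((((hsub.const_mul m).const_add c).mul hsub.sin).add
      (hsub.cos.const_mul m)).congr_deriv ?_
    simp only [id]
    ring
  rw [integral_eq_sub_of_hasDerivAt (fun s _ => hderiv s)
    (Continuous.intervalIntegrable (by fun_prop) _ _), add_sub_cancel_left, sub_self, sin_two_pi,
    cos_two_pi, sin_zero, cos_zero]
  ring

/-- The affine interpolant of `h` at the two zeros of the cosine is orthogonal to the cosine, and
by strict convexity `h` minus this interpolant has the sign of the cosine. -/
lemma integral_mul_cos_period_pos (hh : StrictConvexOn ℝ (Ioo a (a + 2 * π)) h)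
    (hi : IntervalIntegrable h volume a (a + 2 * π)) :
    0 < ∫ s in a..a + 2 * π, h s * cos (s - a) := by
  have hπ := pi_pos
  set x := a + π / 2 with hx
  set y := a + 3 * π / 2 with hy
  set m := (h y - h x) / (y - x)
  have hcos : Continuous fun s => cos (s - a) := by fun_prop
  have hsub : ∫ s in a..a + 2 * π, (h s - (h x + m * (s - x))) * cos (s - a) =
      ∫ s in a..a + 2 * π, h s * cos (s - a) := by
    have haffine (s : ℝ) : h x + m * (s - x) = h x - m * (π / 2) + m * (s - a) := by
      rw [hx]
      ring
    simp only [sub_mul, haffine]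
    rw [intervalIntegral.integral_sub (hi.mul_continuousOn hcos.continuousOn)
      (Continuous.intervalIntegrable (by fun_prop) _ _), integral_affine_mul_cos_period, sub_zero]
  rw [← hsub]
  refine intervalIntegral_pos_of_pos_on_diff (S := {x, y}) ?_ (toFinite _).countable
    (fun s hs => ?_) (by linarith)
  · exact (hi.sub (Continuous.intervalIntegrable (by fun_prop) _ _)).mul_continuousOn
      hcos.continuousOn
  obtain ⟨hs, hne⟩ := hs
  rw [mem_insert_iff, mem_singleton_iff, not_or] at hne
  have hconvex := sub_secant_mul_sub_mul_sub_pos hh (x := x) (y := y)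
    ⟨by linarith, by linarith⟩ ⟨by linarith, by linarith⟩ hs (by linarith) hne.1 hne.2
  have hsign := cos_mul_sub_mul_sub_pos (x := s - a) ⟨by linarith [hs.1], by linarith [hs.2]⟩
    (fun h => hne.1 (by linarith)) (fun h => hne.2 (by linarith))
  rw [sub_sub, sub_sub] at hsign
  refine pos_of_mul_pos_left (b := ((s - x) * (s - y)) ^ 2) ?_ (sq_nonneg _)
  calc 0 < _ := mul_pos hconvex hsign
    _ = _ := by ring

lemma integral_mul_cos_periods_pos {n : ℕ} (hn : n ≠ 0)
    (hh : StrictConvexOn ℝ (Ioo a (a + n * (2 * π))) h)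
    (hi : IntervalIntegrable h volume a (a + n * (2 * π))) :
    0 < ∫ s in a..a + n * (2 * π), h s * cos (s - a) := by
  have hsucc (k : ℕ) : a + (k + 1 : ℕ) * (2 * π) = a + k * (2 * π) + 2 * π := by
    push_cast
    ring
  have hle {k l : ℕ} (hkl : k ≤ l) : a + k * (2 * π) ≤ a + l * (2 * π) := by
    gcongr
  have hzero : a + (0 : ℕ) * (2 * π) = a := by
    rw [Nat.cast_zero, zero_mul, add_zero]
  have hint {k : ℕ} (hk : k < n) :
      IntervalIntegrable h volume (a + k * (2 * π)) (a + (k + 1 : ℕ) * (2 * π)) := by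
    refine hi.mono_set ?_
    rw [uIcc_of_le (hle k.le_succ), uIcc_of_le (hzero.symm.trans_le (hle n.zero_le))]
    exact Icc_subset_Icc (hzero.symm.trans_le (hle k.zero_le)) (hle hk)
  have hcos : Continuous fun s => cos (s - a) := by fun_prop
  have hsum := sum_integral_adjacent_intervals (a := fun k : ℕ => a + k * (2 * π))
    fun k (hk : k < n) => (hint hk).mul_continuousOn hcos.continuousOn
  rw [hzero] at hsum
  rw [← hsum]
  refine Finset.sum_pos (fun k hk => ?_) (Finset.nonempty_range_iff.2 hn)
  have hk := Finset.mem_range.1 hk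
  have hint := hint hk
  have hright := hle hk
  rw [hsucc] at hint hright ⊢
  have hperiod := integral_mul_cos_period_pos
    (hh.subset (Ioo_subset_Ioo (hzero.symm.trans_le (hle k.zero_le)) hright) (convex_Ioo _ _)) hint
  simpa only [← sub_sub, cos_sub_nat_mul_two_pi] using hperiod

lemma integral_mul_cos_half_period_neg (hh : StrictMonoOn h (Ioo 0 π))
    (hi : IntervalIntegrable h volume 0 π) : ∫ s in (0 : ℝ)..π, h s * cos s < 0 := by
  have hπ := pi_pos
  have hmid : π / 2 ∈ Ioo 0 π := ⟨by linarith, by linarith⟩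
  have hsub : ∫ s in (0 : ℝ)..π, (h (π / 2) - h s) * cos s =
      -∫ s in (0 : ℝ)..π, h s * cos s := by
    simp only [sub_mul]
    rw [intervalIntegral.integral_sub ((continuous_cos.const_mul _).intervalIntegrable _ _)
      (hi.mul_continuousOn continuous_cos.continuousOn), intervalIntegral.integral_const_mul,
      integral_cos, sin_pi, sin_zero, sub_self, mul_zero, zero_sub]
  rw [← neg_pos, ← hsub]
  refine intervalIntegral_pos_of_pos_on_diff (S := {π / 2})
    ((intervalIntegrable_const.sub hi).mul_continuousOn continuous_cos.continuousOn)
    (countable_singleton _) (fun s hs => ?_) hπ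
  rcases lt_or_gt_of_ne hs.2 with hlt | hgt
  · exact mul_pos (sub_pos.2 (hh hs.1 hmid hlt)) (cos_pos_of_mem_Ioo ⟨by linarith [hs.1.1], hlt⟩)
  · exact mul_pos_of_neg_of_neg (sub_neg.2 (hh hmid hs.1 hgt))
      (cos_neg_of_pi_div_two_lt_of_lt hgt (by linarith [hs.1.2]))

end cosineIntegrals

/-- The weight against which `cos (2αs)` is integrated in `C11`. -/
def weight (p s : ℝ) : ℝ := s / √(gap p s)

section weight

variable {p : ℝ}

lemma intervalIntegrable_weight (hp : 0 ≤ p) : IntervalIntegrable (weight p) volume 0 1 := by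
  refine intervalIntegrable_of_abs_le_div_sqrt_gap (C := 1) hp
    (measurable_id.div (measurable_gap p).sqrt) fun s hs => ?_
  rw [weight, abs_div, abs_of_pos hs.1, abs_of_pos (sqrt_gap_pos hp hs), one_mul]
  have := sqrt_gap_pos hp hs
  gcongr
  exact hs.2.le

lemma strictAntiOn_gap (hp : 0 ≤ p) : StrictAntiOn (gap p) (Ici 0) := fun _ hs _ _ hst =>
  sub_lt_sub_left (rpow_lt_rpow hs hst (by positivity)) 1

lemma strictMonoOn_weight (hp : 0 ≤ p) : StrictMonoOn (weight p) (Ioo 0 1) := by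
  intro s hs t ht hst
  have hgap := strictAntiOn_gap hp hs.1.le ht.1.le hst
  exact div_lt_div₀ hst (Real.sqrt_le_sqrt hgap.le) ht.1.le (sqrt_gap_pos hp ht)

lemma hasDerivAt_weight (hp : 0 ≤ p) {s : ℝ} (hs : s ∈ Ioo (0 : ℝ) 1) :
    HasDerivAt (weight p)
      (1 / √(gap p s) + (p + 1) / 2 * (s ^ (p + 1) / (gap p s * √(gap p s)))) s := by
  have hgap := gap_pos_of_mem_Ioo hp hs
  have hsqrt := sqrt_gap_pos hp hs
  have hsq : √(gap p s) ^ 2 = gap p s := Real.sq_sqrt hgap.le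
  refine ((hasDerivAt_id s).div ((hasDerivAt_gap hs.1.ne').sqrt hgap.ne') hsqrt.ne').congr_deriv ?_
  simp only [id, hsq, rpow_add hs.1, rpow_one]
  field_simp
  rw [hsq]
  ring

lemma strictConvexOn_weight (hp : 0 ≤ p) : StrictConvexOn ℝ (Ioo 0 1) (weight p) := by
  refine StrictMonoOn.strictConvexOn_of_deriv (convex_Ioo 0 1)
    (fun s hs => (hasDerivAt_weight hp hs).continuousAt.continuousWithinAt) ?_
  rw [interior_Ioo]
  intro s hs t ht hst
  rw [(hasDerivAt_weight hp hs).deriv, (hasDerivAt_weight hp ht).deriv]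
  have hgap := strictAntiOn_gap hp hs.1.le ht.1.le hst
  have hgapt := gap_pos_of_mem_Ioo hp ht
  have := hgapt.trans hgap
  have hsqrtt := sqrt_gap_pos hp ht
  have hs := hs.1.le
  have ht := ht.1.le
  refine add_lt_add_of_lt_of_le
    (one_div_lt_one_div_of_lt hsqrtt (Real.sqrt_lt_sqrt hgapt.le hgap)) ?_
  gcongr

lemma two_mul_C11_eq (hp : -1 < p) {α : ℝ} (hα : α ≠ 0) :
    2 * α * C11 p α = ∫ t in (0 : ℝ)..2 * α, weight p (t / (2 * α)) * cos t := by
  have hα : 2 * α ≠ 0 := mul_ne_zero two_ne_zero hα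
  have hscale := integral_eq_mul_integral_comp_mul
    (fun t => weight p (t / (2 * α)) * cos t) (2 * α)
  rw [hscale, C11_eq hp, gapInt]
  simp only [mul_div_cancel_left₀ _ hα, weight, pow_zero, one_mul, mul_div_right_comm]

lemma div_mem_Ioo {c t : ℝ} (ht : t ∈ Ioo 0 c) : t / c ∈ Ioo (0 : ℝ) 1 :=
  ⟨div_pos ht.1 (ht.1.trans ht.2), (div_lt_one (ht.1.trans ht.2)).2 ht.2⟩

lemma strictMonoOn_weight_div (hp : 0 ≤ p) (c : ℝ) :
    StrictMonoOn (fun t => weight p (t / c)) (Ioo 0 c) := fun _ hs _ ht hst =>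
  strictMonoOn_weight hp (div_mem_Ioo hs) (div_mem_Ioo ht)
    (div_lt_div_of_pos_right hst (hs.1.trans hs.2))

lemma strictConvexOn_weight_div (hp : 0 ≤ p) (c : ℝ) :
    StrictConvexOn ℝ (Ioo 0 c) fun t => weight p (t / c) := by
  refine ⟨convex_Ioo _ _, fun x hx y hy hxy u v hu hv huv => ?_⟩
  have hc : c ≠ 0 := (hx.1.trans hx.2).ne'
  have hconvex := (strictConvexOn_weight hp).2 (div_mem_Ioo hx) (div_mem_Ioo hy)
    (by rwa [ne_eq, div_left_inj' hc]) hu hv huv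
  rwa [smul_eq_mul, smul_eq_mul, mul_div_assoc', mul_div_assoc', ← add_div] at hconvex

lemma intervalIntegrable_weight_div (hp : 0 ≤ p) {c : ℝ} (hc : c ≠ 0) :
    IntervalIntegrable (fun t => weight p (t / c)) volume 0 c := by
  simpa [hc, div_eq_mul_inv] using (intervalIntegrable_weight hp).comp_mul_right (c := c⁻¹)

lemma C11_pos (hp : 0 ≤ p) {n : ℕ} (hn : n ≠ 0) : 0 < C11 p (n * π) := by
  have hα : 0 < n * π := mul_pos (by positivity) pi_pos
  have hend : 2 * (n * π) = n * (2 * π) := by ring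
  have hperiods := integral_mul_cos_periods_pos (h := fun t => weight p (t / (2 * (n * π))))
    (a := 0) hn
  simp only [zero_add, sub_zero, ← hend] at hperiods
  refine pos_of_mul_pos_right (a := 2 * (n * π)) ?_ (by positivity)
  rw [two_mul_C11_eq (by linarith) hα.ne']
  exact hperiods (strictConvexOn_weight_div hp _) (intervalIntegrable_weight_div hp (by positivity))

lemma C11_neg (hp : 0 ≤ p) {n : ℕ} (hn : n ≠ 0) : C11 p (n * π + π / 2) < 0 := by
  set c := 2 * (n * π + π / 2) with hc
  have hn' : 0 < n * (2 * π) := by positivity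
  have hend : c = π + n * (2 * π) := by ring
  have hπ : π ∈ Icc 0 c := ⟨pi_pos.le, by linarith⟩
  have hint := intervalIntegrable_weight_div hp (hπ.1.trans_lt (by linarith : π < c)).ne'
  have hint₁ := hint.mono_set (uIcc_subset_uIcc left_mem_uIcc (Icc_subset_uIcc hπ))
  have hint₂ := hint.mono_set (uIcc_subset_uIcc (Icc_subset_uIcc hπ) right_mem_uIcc)
  have hhalf := integral_mul_cos_half_period_neg
    ((strictMonoOn_weight_div hp c).mono (Ioo_subset_Ioo_right hπ.2)) hint₁
  have hperiods := integral_mul_cos_periods_pos (h := fun t => weight p (t / c)) (a := π) hn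
  simp only [← hend, cos_sub_pi, mul_neg, intervalIntegral.integral_neg, neg_pos] at hperiods
  have hperiods := hperiods
    ((strictConvexOn_weight_div hp c).subset (Ioo_subset_Ioo_left hπ.1) (convex_Ioo _ _)) hint₂
  refine neg_of_mul_neg_right (a := c) ?_ (hπ.1.trans hπ.2)
  rw [hc, two_mul_C11_eq (by linarith) (by positivity), ← hc, ← integral_add_adjacent_intervals
    (hint₁.mul_continuousOn continuous_cos.continuousOn)
    (hint₂.mul_continuousOn continuous_cos.continuousOn)]
  exact add_neg hhalf hperiods

lemma frequently_C11_pos (hp : 0 ≤ p) : ∃ᶠ α in atTop, 0 < C11 p α :=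
  (tendsto_natCast_atTop_atTop.atTop_mul_const pi_pos).frequently
    ((eventually_ne_atTop 0).mono fun _ hn => C11_pos hp hn).frequently

lemma frequently_C11_neg (hp : 0 ≤ p) : ∃ᶠ α in atTop, C11 p α < 0 :=
  (tendsto_atTop_add_const_right _ _
    (tendsto_natCast_atTop_atTop.atTop_mul_const pi_pos)).frequently
    ((eventually_ne_atTop 0).mono fun _ hn => C11_neg hp hn).frequently

end weight

section boundedness

variable {p q r : ℝ} {f g : ℝ → ℝ}

lemma mul_isBigO_one (hf : f =O[atTop] fun _ => (1 : ℝ)) (hg : g =O[atTop] fun _ => (1 : ℝ)) :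
    (fun α => f α * g α) =O[atTop] fun _ => (1 : ℝ) := by
  simpa only [mul_one] using! hf.mul hg

lemma isBigO_one_mul_isLittleO {m : ℝ → ℝ} (hf : f =O[atTop] fun _ => (1 : ℝ))
    (hg : g =o[atTop] m) : (fun α => f α * g α) =o[atTop] m := by
  simpa only [one_mul] using! hf.mul_isLittleO hg

lemma isLittleO_mul_of_tendsto_zero (hf : Tendsto f atTop (𝓝 0)) (m : ℝ → ℝ) :
    (fun α => f α * m α) =o[atTop] m := by
  simpa only [one_mul] using!
    ((isLittleO_one_iff ℝ).2 hf).mul_isBigO (isBigO_refl m atTop)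

lemma tendsto_rpow_atTop_zero (hq : q < 0) : Tendsto (fun α : ℝ => α ^ q) atTop (𝓝 0) := by
  simpa only [neg_neg] using tendsto_rpow_neg_atTop (neg_pos.2 hq)

lemma isLittleO_rpow_rpow_atTop (h : q < r) :
    (fun α : ℝ => α ^ q) =o[atTop] fun α => α ^ r := by
  refine (isLittleO_mul_of_tendsto_zero (tendsto_rpow_atTop_zero (sub_neg.2 h)) _).congr' ?_ .rfl
  filter_upwards [eventually_gt_atTop 0] with α hα
  rw [← rpow_add hα, sub_add_cancel]

lemma isBigO_one_mul_tendsto_zero (hf : f =O[atTop] fun _ => (1 : ℝ))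
    (hg : Tendsto g atTop (𝓝 0)) : Tendsto (fun α => f α * g α) atTop (𝓝 0) :=
  (isLittleO_one_iff ℝ).1 (isBigO_one_mul_isLittleO hf ((isLittleO_one_iff ℝ).2 hg))

lemma isBigO_one_mul_rpow_tendsto_zero (hf : f =O[atTop] fun _ => (1 : ℝ)) (hq : q < 0) :
    Tendsto (fun α => f α * α ^ q) atTop (𝓝 0) :=
  isBigO_one_mul_tendsto_zero hf (tendsto_rpow_atTop_zero hq)

lemma gapInt_isBigO_one {n : ℕ} {φ : ℝ → ℝ → ℝ} {C : ℝ} (hp : 0 ≤ p)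
    (h : ∀ α, ∀ s ∈ Ioo (0 : ℝ) 1, |φ α s| ≤ C * gap p s ^ n) :
    (fun α => gapInt p n (φ α)) =O[atTop] fun _ => (1 : ℝ) :=
  .of_bound (C * C0 p) <| .of_forall fun α => by
    simpa only [norm_one, mul_one] using! abs_gapInt_le hp (h α)

lemma gapInt_zero_isBigO_one {φ : ℝ → ℝ → ℝ} {C : ℝ} (hp : 0 ≤ p)
    (h : ∀ α, ∀ s ∈ Ioo (0 : ℝ) 1, |φ α s| ≤ C) :
    (fun α => gapInt p 0 (φ α)) =O[atTop] fun _ => (1 : ℝ) :=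
  gapInt_isBigO_one (C := C) hp fun α s hs => by simpa only [pow_zero, mul_one] using h α s hs

lemma abs_mul_le_one {s x : ℝ} (hs : s ∈ Ioo (0 : ℝ) 1) (hx : |x| ≤ 1) : |s * x| ≤ 1 := by
  rw [abs_mul, abs_of_pos hs.1]
  exact mul_le_one₀ hs.2.le (abs_nonneg _) hx

lemma abs_sub_le_one_add_one {x y : ℝ} (hx : |x| ≤ 1) (hy : |y| ≤ 1) : |x - y| ≤ 1 + 1 :=
  (abs_sub _ _).trans (add_le_add hx hy)

lemma C11_isBigO_one (hp : 0 ≤ p) : C11 p =O[atTop] fun _ => (1 : ℝ) := by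
  rw [funext (C11_eq (by linarith))]
  exact gapInt_zero_isBigO_one hp fun _ _ hs => abs_mul_le_one hs (abs_cos_le_one _)

lemma C12_isBigO_one (hp : 0 ≤ p) : C12 p =O[atTop] fun _ => (1 : ℝ) := by
  rw [funext (C12_eq hp)]
  refine ((gapInt_zero_isBigO_one hp fun _ _ _ => abs_sub_le_one_add_one (abs_sin_le_one _)
    (abs_sin_le_one _)).const_mul_left _).add
    ((gapInt_isBigO_one (C := 1) hp fun α s hs => ?_).const_mul_left _)
  calc |(1 - s) * sin (2 * α * s)| ≤ |1 - s| := abs_mul_sin_le _ _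
    _ = 1 - s := abs_of_pos (sub_pos.2 hs.2)
    _ ≤ 1 * gap p s ^ 1 := by
        rw [pow_one, one_mul]
        exact one_sub_le_gap hp (Ioo_subset_Icc_self hs)

lemma C21_isBigO_one (hp : 0 ≤ p) : C21 p =O[atTop] fun _ => (1 : ℝ) := by
  rw [funext (C21_eq (by linarith))]
  exact (gapInt_zero_isBigO_one hp fun _ _ hs =>
    abs_mul_le_one hs (abs_sin_le_one _)).const_mul_left _

lemma C22_isBigO_one (hp : 0 ≤ p) : C22 p =O[atTop] fun _ => (1 : ℝ) := by
  rw [funext (C22_eq (by linarith))]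
  exact (gapInt_zero_isBigO_one hp fun _ _ _ =>
    abs_sub_le_one_add_one (abs_cos_le_one _) (abs_cos_le_one _)).const_mul_left _

lemma E2_isBigO_one (hp : 0 ≤ p) : E2 p =O[atTop] fun _ => (1 : ℝ) := by
  rw [funext (E2_eq (by linarith))]
  exact (gapInt_zero_isBigO_one hp fun _ _ hs => abs_sub_le_one_add_one (abs_sin_le_one _)
    (abs_mul_le_one hs (abs_sin_le_one _))).const_mul_left _

lemma E3_isBigO_one (hp : 0 ≤ p) : E3 p =O[atTop] fun _ => (1 : ℝ) := by
  rw [funext (E3_eq (by linarith))]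
  exact (gapInt_zero_isBigO_one hp fun _ _ _ =>
    abs_sub_le_one_add_one (abs_cos_le_one _) (abs_cos_le_one _)).const_mul_left _

lemma C1_add_half_C11_isBigO_one (hp : 0 ≤ p) :
    (fun α => C1 p + 1 / 2 * C11 p α) =O[atTop] fun _ => (1 : ℝ) :=
  (isBigO_const_one ℝ _ _).add ((C11_isBigO_one hp).const_mul_left _)

lemma half_C12_add_C21_isBigO_one (hp : 0 ≤ p) :
    (fun α => 1 / 2 * (C12 p α + C21 p α)) =O[atTop] fun _ => (1 : ℝ) :=
  ((C12_isBigO_one hp).add (C21_isBigO_one hp)).const_mul_left _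

lemma half_C22_isBigO_one (hp : 0 ≤ p) :
    (fun α => 1 / 2 * C22 p α) =O[atTop] fun _ => (1 : ℝ) :=
  (C22_isBigO_one hp).const_mul_left _

lemma G2_isBigO_one (hp : 0 ≤ p) : G2 p =O[atTop] fun _ => (1 : ℝ) :=
  (mul_isBigO_one (half_C12_add_C21_isBigO_one hp) (isBigO_const_one ℝ _ _)).add
    ((E2_isBigO_one hp).const_mul_left _)

lemma G3_isBigO_one (hp : 0 ≤ p) : G3 p =O[atTop] fun _ => (1 : ℝ) :=
  (mul_isBigO_one (half_C22_isBigO_one hp) (isBigO_const_one ℝ _ _)).add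
    ((E3_isBigO_one hp).const_mul_left _)

end boundedness

section expansions

/-- The expansion of `normTime p α` up to `o(α^{2(1-p)})`. -/
def timeExpansion (p α : ℝ) : ℝ :=
  C0 p + (C1 p + 1 / 2 * C11 p α) * α ^ (1 - p) + 1 / 2 * (C12 p α + C21 p α) * α ^ (-p)
    + 1 / 2 * C22 p α * α ^ (-(p + 1)) + C2 p * α ^ (2 * (1 - p))

/-- The expansion of `normVel p α` up to `o(α^{2(1-p)})`. -/
def velExpansion (p α : ℝ) : ℝ :=
  E0 p + E1 p * α ^ (1 - p) + E2 p α * α ^ (-p) + E3 p α * α ^ (-(p + 1))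
    + E4 p * α ^ (2 * (1 - p))

/-- The expansion of `normTime p α * normVel p α` up to `o(α^{2(1-p)})`. -/
def timeVelExpansion (p α : ℝ) : ℝ :=
  G0 p + G1 p α * α ^ (1 - p) + G2 p α * α ^ (-p) + G3 p α * α ^ (-(p + 1))
    + G4 p α * α ^ (2 * (1 - p))

variable {p α : ℝ}

lemma rpow_neg_eq_mul_inv (hα : 0 < α) : α ^ (-p) = α ^ (1 - p) * α⁻¹ := by
  rw [← rpow_neg_one, ← rpow_add hα]
  congr 1
  ring

lemma rpow_neg_add_one_eq_mul_inv_sq (hα : 0 < α) :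
    α ^ (-(p + 1)) = α ^ (1 - p) * α⁻¹ ^ 2 := by
  rw [pow_two, ← mul_assoc, ← rpow_neg_eq_mul_inv hα, ← rpow_neg_one, ← rpow_add hα]
  congr 1
  ring

lemma rpow_two_mul_eq_sq (hα : 0 < α) : α ^ (2 * (1 - p)) = (α ^ (1 - p)) ^ 2 := by
  rw [mul_comm, rpow_mul hα.le, rpow_two]

lemma isLittleO_of_abs_sub_le {f g : ℝ → ℝ} {K L : ℝ} (hp : 1 < p)
    (hf : ∀ α, 0 < α → |f α - (α ^ (1 - p)) ^ 2 * g α| ≤ K * (α ^ (1 - p)) ^ 3)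
    (hg : Tendsto g atTop (𝓝 L)) :
    (fun α => f α - L * α ^ (2 * (1 - p))) =o[atTop] fun α => α ^ (2 * (1 - p)) := by
  have hcubic : (fun α => f α - g α * α ^ (2 * (1 - p))) =O[atTop] fun α => α ^ (3 * (1 - p)) := by
    refine .of_bound K ?_
    filter_upwards [eventually_gt_atTop 0] with α hα
    rw [Real.norm_eq_abs, Real.norm_of_nonneg (rpow_nonneg hα.le _), mul_comm (g α),
      rpow_two_mul_eq_sq hα, mul_comm 3, rpow_mul hα.le, rpow_ofNat]
    exact hf α hα
  have hquadratic := isLittleO_mul_of_tendsto_zero (sub_self L ▸ hg.sub_const L)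
    fun α => α ^ (2 * (1 - p))
  refine ((hcubic.trans_isLittleO (isLittleO_rpow_rpow_atTop (by linarith))).add
    hquadratic).congr_left fun α => ?_
  ring

lemma normTime_sub_timeExpansion_isLittleO (hp : 1 < p) :
    (fun α => normTime p α - timeExpansion p α) =o[atTop] fun α => α ^ (2 * (1 - p)) := by
  have hp0 : 0 ≤ p := by linarith
  have hlim := (tendsto_gapInt_sq hp.le le_rfl).const_mul (3 * (p + 1) ^ 2 / 128)
  rw [← C2_eq hp0] at hlim
  refine (isLittleO_of_abs_sub_le (f := fun α => normTime p α - (timeExpansion p α -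
    C2 p * α ^ (2 * (1 - p)))) (K := ((p + 1) / 2) ^ 3 * C0 p) hp (fun α hα => ?_)
    hlim).congr_left fun α => by ring
  have htaylor := abs_integral_one_div_sqrt_gap_add_sub_le hp0 (measurable_pert p α)
    (fun s hs => pert_nonneg hp0 hα (Ioo_subset_Icc_self hs))
    fun s hs => pert_le hp.le hα (Ioo_subset_Icc_self hs)
  have hlinear := gapInt_one_pert hp.le hα
  rw [gapInt_pert_sq 2 hα] at htaylor
  convert htaylor using 1
  · rw [normTime, timeExpansion, rpow_neg_eq_mul_inv hα, rpow_neg_add_one_eq_mul_inv_sq hα]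
    simp only [div_eq_mul_inv, inv_pow] at hlinear ⊢
    congr 1
    linear_combination hlinear
  · ring

lemma normVel_sub_velExpansion_isLittleO (hp : 1 < p) :
    (fun α => normVel p α - velExpansion p α) =o[atTop] fun α => α ^ (2 * (1 - p)) := by
  have hp0 : 0 ≤ p := by linarith
  have hlim := (tendsto_gapInt_sq hp.le one_le_two).const_mul (-((p + 1) ^ 2 / 128))
  rw [← E4_eq hp0] at hlim
  refine (isLittleO_of_abs_sub_le (f := fun α => normVel p α - (velExpansion p α -
    E4 p * α ^ (2 * (1 - p)))) (K := ((p + 1) / 2) ^ 3 * C0 p) hp (fun α hα => ?_)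
    hlim).congr_left fun α => by ring
  have htaylor := abs_integral_sqrt_gap_add_sub_le hp0 (measurable_pert p α)
    (fun s hs => pert_nonneg hp0 hα (Ioo_subset_Icc_self hs))
    fun s hs => pert_le hp.le hα (Ioo_subset_Icc_self hs)
  have hlinear := gapInt_zero_pert hp.le hα
  rw [gapInt_pert_sq 1 hα] at htaylor
  convert htaylor using 1
  · rw [normVel, velExpansion, rpow_neg_eq_mul_inv hα, rpow_neg_add_one_eq_mul_inv_sq hα]
    simp only [div_eq_mul_inv, inv_pow] at hlinear ⊢
    congr 1
    linear_combination hlinear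
  · ring

lemma tendsto_of_sub_isLittleO_rpow {f g : ℝ → ℝ} {q L : ℝ} (hq : q < 0)
    (h : (fun α => f α - g α) =o[atTop] fun α => α ^ q) (hg : Tendsto g atTop (𝓝 L)) :
    Tendsto f atTop (𝓝 L) := by
  simpa only [sub_add_cancel, zero_add] using
    (h.trans_tendsto (tendsto_rpow_atTop_zero hq)).add hg

lemma tendsto_timeExpansion (hp : 1 < p) : Tendsto (timeExpansion p) atTop (𝓝 (C0 p)) := by
  have hp0 : 0 ≤ p := by linarith
  have hlim := ((((tendsto_const_nhds (x := C0 p)).add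
    (isBigO_one_mul_rpow_tendsto_zero (C1_add_half_C11_isBigO_one hp0) (sub_neg.2 hp))).add
    (isBigO_one_mul_rpow_tendsto_zero (half_C12_add_C21_isBigO_one hp0)
    (by linarith : -p < 0))).add
    (isBigO_one_mul_rpow_tendsto_zero (half_C22_isBigO_one hp0) (by linarith : -(p + 1) < 0))).add
    (isBigO_one_mul_rpow_tendsto_zero (isBigO_const_one ℝ (C2 p) _) (by linarith : 2 * (1 - p) < 0))
  simpa only [add_zero] using! hlim

lemma tendsto_velExpansion (hp : 1 < p) : Tendsto (velExpansion p) atTop (𝓝 (E0 p)) := by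
  have hp0 : 0 ≤ p := by linarith
  have hlim := ((((tendsto_const_nhds (x := E0 p)).add
    (isBigO_one_mul_rpow_tendsto_zero (isBigO_const_one ℝ (E1 p) _) (by linarith : 1 - p < 0))).add
    (isBigO_one_mul_rpow_tendsto_zero (E2_isBigO_one hp0) (by linarith : -p < 0))).add
    (isBigO_one_mul_rpow_tendsto_zero (E3_isBigO_one hp0) (by linarith : -(p + 1) < 0))).add
    (isBigO_one_mul_rpow_tendsto_zero (isBigO_const_one ℝ (E4 p) _) (by linarith : 2 * (1 - p) < 0))
  simpa only [add_zero] using! hlim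

lemma tendsto_normTime (hp : 1 < p) : Tendsto (normTime p) atTop (𝓝 (C0 p)) :=
  tendsto_of_sub_isLittleO_rpow (by linarith) (normTime_sub_timeExpansion_isLittleO hp)
    (tendsto_timeExpansion hp)

lemma tendsto_normVel (hp : 1 < p) : Tendsto (normVel p) atTop (𝓝 (E0 p)) :=
  tendsto_of_sub_isLittleO_rpow (by linarith) (normVel_sub_velExpansion_isLittleO hp)
    (tendsto_velExpansion hp)

lemma normTime_mul_normVel_sub_isLittleO (hp : 1 < p) :
    (fun α => normTime p α * normVel p α - timeExpansion p α * velExpansion p α) =o[atTop]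
      fun α => α ^ (2 * (1 - p)) := by
  refine ((isBigO_one_mul_isLittleO ((tendsto_normVel hp).isBigO_one ℝ)
    (normTime_sub_timeExpansion_isLittleO hp)).add (isBigO_one_mul_isLittleO
    ((tendsto_timeExpansion hp).isBigO_one ℝ)
    (normVel_sub_velExpansion_isLittleO hp))).congr_left fun α => ?_
  ring

lemma timeExpansion_mul_velExpansion_sub_isLittleO (hp : 1 < p) :
    (fun α => timeExpansion p α * velExpansion p α - timeVelExpansion p α) =o[atTop]
      fun α => α ^ (2 * (1 - p)) := by
  have hp0 : 0 ≤ p := by linarith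
  set a : ℝ → ℝ := fun α => C1 p + 1 / 2 * C11 p α with ha
  set c : ℝ → ℝ := fun α => 1 / 2 * (C12 p α + C21 p α) + 1 / 2 * C22 p α * α⁻¹ with hc
  set e : ℝ → ℝ := fun α => E2 p α + E3 p α * α⁻¹ with he
  have hinv : (fun α : ℝ => α⁻¹) =O[atTop] fun _ => (1 : ℝ) := tendsto_inv_atTop_zero.isBigO_one ℝ
  have hpow := tendsto_rpow_atTop_zero (sub_neg.2 hp)
  have ha_bdd : a =O[atTop] fun _ => (1 : ℝ) := C1_add_half_C11_isBigO_one hp0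
  have hc_bdd : c =O[atTop] fun _ => (1 : ℝ) := (half_C12_add_C21_isBigO_one hp0).add
    (mul_isBigO_one (half_C22_isBigO_one hp0) hinv)
  have he_bdd : e =O[atTop] fun _ => (1 : ℝ) :=
    (E2_isBigO_one hp0).add (mul_isBigO_one (E3_isBigO_one hp0) hinv)
  have htime := ha_bdd.add (mul_isBigO_one hc_bdd hinv)
  have hvel := (isBigO_const_one ℝ (E1 p) atTop).add (mul_isBigO_one he_bdd hinv)
  have hcross := isBigO_one_mul_tendsto_zero
    ((mul_isBigO_one hc_bdd hvel).add (mul_isBigO_one ha_bdd he_bdd)) tendsto_inv_atTop_zero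
  have hcubic := isBigO_one_mul_tendsto_zero (((htime.const_mul_left (E4 p)).add
    (hvel.const_mul_left (C2 p))).add ((hpow.isBigO_one ℝ).const_mul_left (C2 p * E4 p))) hpow
  have hcoeff := (hcross.sub ((tendsto_C3 hp.le).const_mul (E0 p))).add hcubic
  rw [mul_zero, sub_zero, add_zero] at hcoeff
  refine (isLittleO_mul_of_tendsto_zero hcoeff _).congr' ?_ .rfl
  filter_upwards [eventually_gt_atTop 0] with α hα
  simp only [timeExpansion, velExpansion, timeVelExpansion, G0, G1, G2, G3, G4, ha, hc, he]
  rw [rpow_neg_eq_mul_inv hα, rpow_neg_add_one_eq_mul_inv_sq hα, rpow_two_mul_eq_sq hα]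
  ring

lemma normTime_mul_normVel_sub_timeVelExpansion_isLittleO (hp : 1 < p) :
    (fun α => normTime p α * normVel p α - timeVelExpansion p α) =o[atTop]
      fun α => α ^ (2 * (1 - p)) :=
  ((normTime_mul_normVel_sub_isLittleO hp).add
    (timeExpansion_mul_velExpansion_sub_isLittleO hp)).congr_left fun _ => sub_add_sub_cancel _ _ _

end expansions

section expansionCases

variable {p : ℝ}

lemma normTime_two_isLittleO :
    (fun α => normTime 2 α - (C0 2 + (C1 2 + 1 / 2 * C11 2 α) * α ^ (-1 : ℝ)
      + (1 / 2 * C12 2 α + 1 / 2 * C21 2 α + C2 2 + C3 2 α) * α ^ (-2 : ℝ))) =o[atTop]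
      fun α => α ^ (-2 : ℝ) := by
  have hmain := normTime_sub_timeExpansion_isLittleO one_lt_two
  have hC22 := isBigO_one_mul_isLittleO (half_C22_isBigO_one zero_le_two)
    (isLittleO_rpow_rpow_atTop (by norm_num : (-(2 + 1) : ℝ) < -2))
  have hC3 := isLittleO_mul_of_tendsto_zero (tendsto_C3 one_le_two) fun α => α ^ (-2 : ℝ)
  unfold timeExpansion at hmain
  rw [show (2 * (1 - 2) : ℝ) = -2 by norm_num, show (1 - 2 : ℝ) = -1 by norm_num] at hmain
  refine ((hmain.add hC22).sub hC3).congr_left fun α => ?_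
  ring

lemma normTime_mul_normVel_two_isLittleO :
    (fun α => normTime 2 α * normVel 2 α - (G0 2 + G1 2 α * α ^ (-1 : ℝ)
      + (G2 2 α + G4 2 α) * α ^ (-2 : ℝ))) =o[atTop] fun α => α ^ (-2 : ℝ) := by
  have hmain := normTime_mul_normVel_sub_timeVelExpansion_isLittleO one_lt_two
  have hG3 := isBigO_one_mul_isLittleO (G3_isBigO_one zero_le_two)
    (isLittleO_rpow_rpow_atTop (by norm_num : (-(2 + 1) : ℝ) < -2))
  unfold timeVelExpansion at hmain
  rw [show (2 * (1 - 2) : ℝ) = -2 by norm_num, show (1 - 2 : ℝ) = -1 by norm_num] at hmain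
  refine (hmain.add hG3).congr_left fun α => ?_
  ring

lemma normTime_isLittleO_of_lt_two (hp : 1 < p) (hp2 : p < 2) :
    (fun α => normTime p α - (C0 p + (C1 p + 1 / 2 * C11 p α) * α ^ (1 - p)
      + C2 p * α ^ (2 * (1 - p)))) =o[atTop] fun α => α ^ (2 * (1 - p)) := by
  have hp0 : 0 ≤ p := by linarith
  have hmain := normTime_sub_timeExpansion_isLittleO hp
  have hC12_C21 := isBigO_one_mul_isLittleO (half_C12_add_C21_isBigO_one hp0)
    (isLittleO_rpow_rpow_atTop (by linarith : -p < 2 * (1 - p)))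
  have hC22 := isBigO_one_mul_isLittleO (half_C22_isBigO_one hp0)
    (isLittleO_rpow_rpow_atTop (by linarith : -(p + 1) < 2 * (1 - p)))
  refine ((hmain.add hC12_C21).add hC22).congr_left fun α => ?_
  rw [timeExpansion]
  ring

lemma normTime_mul_normVel_isLittleO_of_lt_two (hp : 1 < p) (hp2 : p < 2) :
    (fun α => normTime p α * normVel p α - (G0 p + G1 p α * α ^ (1 - p)
      + G4 p α * α ^ (2 * (1 - p)))) =o[atTop] fun α => α ^ (2 * (1 - p)) := by
  have hp0 : 0 ≤ p := by linarith
  have hmain := normTime_mul_normVel_sub_timeVelExpansion_isLittleO hp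
  have hG2 := isBigO_one_mul_isLittleO (G2_isBigO_one hp0)
    (isLittleO_rpow_rpow_atTop (by linarith : -p < 2 * (1 - p)))
  have hG3 := isBigO_one_mul_isLittleO (G3_isBigO_one hp0)
    (isLittleO_rpow_rpow_atTop (by linarith : -(p + 1) < 2 * (1 - p)))
  refine ((hmain.add hG2).add hG3).congr_left fun α => ?_
  rw [timeVelExpansion]
  ring

end expansionCases

section eigenvalue

variable {b p α : ℝ}

/-- The parameter `λ(α)` of the solution of amplitude `α`, in terms of the rescaled time map. -/
def eigenvalue (b p α : ℝ) : ℝ :=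
  2 * (p + 1) * α ^ (1 - p) * normTime p α ^ 2 *
    (4 * b * α ^ 2 * (normTime p α * normVel p α) + 1)

lemma eigenvalue_eq (b : ℝ) (hp : 0 ≤ p) (hα : 0 < α) :
    eigenvalue b p α = (b * energy (isPotential_sourcePot hp hα).solution + 1) *
      (2 * timeMap (sourcePot p) α α ^ 2) := by
  rw [eigenvalue, energy_solution_sourcePot hp hα, two_mul_timeMap_sq hp hα]
  ring

lemma exists_forall_isUniqueSolutionPair (hb : 0 ≤ b) (hp : 0 ≤ p) :
    ∃ v : ℝ → ℝ → ℝ, ∀ α : ℝ, 0 < α →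
      IsUniqueSolutionPair 0 p α (eigenvalue 0 p α) (v α) ∧
      IsUniqueSolutionPair b p α (eigenvalue b p α) (v α) ∧
      eigenvalue b p α = (b * energy (v α) + 1) * eigenvalue 0 p α := by
  refine ⟨fun α => if hα : 0 < α then (isPotential_sourcePot hp hα).solution else 0,
    fun α hα => ?_⟩
  have hpot := isPotential_sourcePot hp hα
  simp only [dif_pos hα]
  refine ⟨?_, ?_, ?_⟩
  · rw [eigenvalue_eq 0 hp hα]
    exact hpot.isUniqueSolutionPair le_rfl
  · rw [eigenvalue_eq b hp hα]
    exact hpot.isUniqueSolutionPair hb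
  · rw [eigenvalue_eq b hp hα, eigenvalue_eq 0 hp hα, zero_mul, zero_add, one_mul]

lemma E0_pos (hp : 0 ≤ p) : 0 < E0 p :=
  intervalIntegral_pos_of_pos_on ((continuous_gap hp).sqrt.intervalIntegrable 0 1)
    (fun _ hs => sqrt_gap_pos hp hs) one_pos

lemma G0_pos (hp : 0 ≤ p) : 0 < G0 p := mul_pos (C0_pos hp) (E0_pos hp)

lemma eigenvalue_div_rpow (hα : 0 < α) :
    eigenvalue b p α / α ^ (3 - p) = 2 * (p + 1) * normTime p α ^ 2 *
      (4 * b * (normTime p α * normVel p α) + α⁻¹ ^ 2) := by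
  have hpow : α ^ (3 - p) = α ^ (1 - p) * α ^ 2 := by
    rw [show 3 - p = 1 - p + 2 by ring, rpow_add hα, rpow_two]
  have : 0 < α ^ (1 - p) := rpow_pos_of_pos hα _
  rw [eigenvalue, hpow]
  field_simp

lemma tendsto_eigenvalue_div_rpow (b : ℝ) (hp : 1 < p) :
    Tendsto (fun α => eigenvalue b p α / α ^ (3 - p)) atTop
      (𝓝 (8 * b * (p + 1) * C0 p ^ 2 * G0 p)) := by
  have htime := tendsto_normTime hp
  have hlim := ((htime.pow 2).const_mul (2 * (p + 1))).mul
    (((htime.mul (tendsto_normVel hp)).const_mul (4 * b)).add (tendsto_inv_atTop_zero.pow 2))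
  rw [show 2 * (p + 1) * C0 p ^ 2 * (4 * b * (C0 p * E0 p) + 0 ^ 2) =
    8 * b * (p + 1) * C0 p ^ 2 * G0 p by rw [G0]; ring] at hlim
  refine hlim.congr' ?_
  filter_upwards [eventually_gt_atTop 0] with α hα
  rw [eigenvalue_div_rpow hα]

end eigenvalue

end Kirchhoff

end

theorem theorem1p6 (b p : ℝ) (hb : 0 < b) (hp : 1 < p) :
    ∃ (lam mu : ℝ → ℝ) (v : ℝ → ℝ → ℝ),
      -- for every `α > 0`: the unique solution pairs for `b = 0` and for the given `b > 0`
      (∀ α : ℝ, 0 < α →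
        IsUniqueSolutionPair 0 p α (mu α) (v α) ∧
        IsUniqueSolutionPair b p α (lam α) (v α) ∧
        lam α = (b * energy (v α) + 1) * mu α) ∧
      -- (i)
      (2 < p → ∃ r₁ r₂ : ℝ → ℝ,
        r₁ =o[atTop] (fun α : ℝ => α ^ (2 * (1 - p))) ∧
        r₂ =o[atTop] (fun α : ℝ => α ^ (2 * (1 - p))) ∧
        ∀ᶠ α in atTop, lam α =
          2 * (p + 1) * α ^ (1 - p) *
            (C0 p + (C1 p + 1 / 2 * C11 p α) * α ^ (1 - p)
              + 1 / 2 * (C12 p α + C21 p α) * α ^ (-p)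
              + 1 / 2 * C22 p α * α ^ (-(p + 1))
              + C2 p * α ^ (2 * (1 - p)) + r₁ α) ^ 2 *
            (4 * b * α ^ 2 *
              (G0 p + G1 p α * α ^ (1 - p) + G2 p α * α ^ (-p) + G3 p α * α ^ (-(p + 1))
                + G4 p α * α ^ (2 * (1 - p)) + r₂ α) + 1)) ∧
      -- (ii)
      (p = 2 → ∃ r₁ r₂ : ℝ → ℝ,
        r₁ =o[atTop] (fun α : ℝ => α ^ (-2 : ℝ)) ∧
        r₂ =o[atTop] (fun α : ℝ => α ^ (-2 : ℝ)) ∧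
        ∀ᶠ α in atTop, lam α =
          6 * α ^ (-1 : ℝ) *
            (C0 p + (C1 p + 1 / 2 * C11 p α) * α ^ (-1 : ℝ)
              + (1 / 2 * C12 p α + 1 / 2 * C21 p α + C2 p + C3 p α) * α ^ (-2 : ℝ)
              + r₁ α) ^ 2 *
            (4 * b * α ^ 2 *
              (G0 p + G1 p α * α ^ (-1 : ℝ) + (G2 p α + G4 p α) * α ^ (-2 : ℝ) + r₂ α) + 1)) ∧
      -- (iii)
      (p < 2 → ∃ r₁ r₂ : ℝ → ℝ,
        r₁ =o[atTop] (fun α : ℝ => α ^ (2 * (1 - p))) ∧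
        r₂ =o[atTop] (fun α : ℝ => α ^ (2 * (1 - p))) ∧
        ∀ᶠ α in atTop, lam α =
          2 * (p + 1) * α ^ (1 - p) *
            (C0 p + (C1 p + 1 / 2 * C11 p α) * α ^ (1 - p)
              + C2 p * α ^ (2 * (1 - p)) + r₁ α) ^ 2 *
            (4 * b * α ^ 2 *
              (G0 p + G1 p α * α ^ (1 - p) + G4 p α * α ^ (2 * (1 - p)) + r₂ α) + 1)) ∧
      -- `lam α ~ α ^ (3 - p)`, with the positive constant made explicit
      0 < 8 * b * (p + 1) * C0 p ^ 2 * G0 p ∧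
      Tendsto (fun α => lam α / α ^ (3 - p)) atTop (𝓝 (8 * b * (p + 1) * C0 p ^ 2 * G0 p)) ∧
      -- the coefficient `C11` in the second term oscillates as `α → ∞`
      (∃ᶠ α in atTop, 0 < C11 p α) ∧ (∃ᶠ α in atTop, C11 p α < 0) := by
  have hp0 : 0 ≤ p := by linarith
  obtain ⟨v, hv⟩ := exists_forall_isUniqueSolutionPair hb.le hp0
  refine ⟨eigenvalue b p, eigenvalue 0 p, v, hv,
    fun _ => ⟨_, _, normTime_sub_timeExpansion_isLittleO hp,
      normTime_mul_normVel_sub_timeVelExpansion_isLittleO hp, .of_forall fun α => ?_⟩, ?_,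
    fun hp2 => ⟨_, _, normTime_isLittleO_of_lt_two hp hp2,
      normTime_mul_normVel_isLittleO_of_lt_two hp hp2, .of_forall fun α => ?_⟩, ?_,
    tendsto_eigenvalue_div_rpow b hp, frequently_C11_pos hp0, frequently_C11_neg hp0⟩
  · rw [← timeExpansion, ← timeVelExpansion, add_sub_cancel, add_sub_cancel, eigenvalue]
  · rintro rfl
    refine ⟨_, _, normTime_two_isLittleO, normTime_mul_normVel_two_isLittleO,
      .of_forall fun α => ?_⟩
    rw [add_sub_cancel, add_sub_cancel, eigenvalue]
    norm_num
  · rw [add_sub_cancel, add_sub_cancel, eigenvalue]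
  · have := C0_pos hp0
    have := G0_pos hp0
    positivity
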